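/- Let $n\ge 0$ and let $P$ be a convex polygon in the plane with vertices labeled $1,\dots,n+1$ in clockwise order (a point if $n=0$, a segment with its two endpoints if $n=1$). *Hypertrees.* A hypergraph on $[n+1]$ is a set of hyperedges, i.e. subsets of $[n+1]$ with at least two elements. A simple cycle of length $k\ge 2$ consists of distinct vertices $v_0,\dots,v_{k-1}$ and distinct hyperedges $e_0,\dots,e_{k-1}$ with $v_i,v_{i+1}\in e_i$ (indices mod $k$). A hypertree is a connected hypergraph without simple cycles, and a tree is a hypertree whose hyperedges all have exactly two elements. A hypergraph is noncrossing if the convex hulls (in $P$) of any two distinct hyperedges are disjoint or meet in exactly one point, which is a vertex of $P$. The hyperedge poset of a noncrossing hypertree $\tau$ is the transitive closure of the relations $e<e'$, where $e\ne e'$ are hyperedges sharing a vertex $v$ such that, looking from $v$ into the interior of $P$, $e$ lies to the left of $e'$. A weak linear ordering of a set $S$ is an ordered partition of $S$ into nonempty blocks, equivalently a function $f$ from $S$ to a linearly ordered set, two functions being identified when they define the same partition of $S$ with the same order of the blocks. It is a linear ordering if $f$ is injective. A weakly properly ordered noncrossing hypertree is a noncrossing hypertree together with a weak linear ordering $f$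 of its hyperedges such that $e<e'$ in the hyperedge poset implies $f(e)<f(e')$; a properly ordered noncrossing tree is one in which the hypertree is a tree and $f$ is a linear ordering. *Noncrossing partition link.* A partition of $[n+1]$ is noncrossing if the convex hulls of distinct blocks are disjoint. Let $\mathrm{NC}_{n+1}$ be the set of noncrossing partitions ordered by refinement, with least element $\hat 0$ (all blocks singletons) and greatest element $\hat 1$ (one block). As a simplicial complex, $\mathrm{Link}(\mathrm{NC}_{n+1})$ is the order complex of $\mathrm{NC}_{n+1}\setminus\{\hat 0,\hat 1\}$: its simplices are the finite chains of this poset, the empty chain (the empty simplex, of dimension $-1$) included. Its top-dimensional simplices are called partition chambers. *Labels.* Identify a noncrossing partition $\pi$ with the permutation of $[n+1]$ that is the product of the cycles through the elements of its blocks in clockwise order. Multiplying permutations from left to right, the label of a pair $\pi<\pi'$ is the permutation $\sigma$ with $\pi\sigma=\pi'$. A simplex of the link determines a chain $\hat 0=\pi_0<\pi_1<\dots<\pi_k=\hat 1$ (its vertices together with $\hat 0$ and $\hat 1$), with labels $\sigma_i$ given by $\pi_{i-1}\sigma_i=\pi_i$ for $1\le i\le k$. **Statement.** There is a bijection from the set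 of simplices of $\mathrm{Link}(\mathrm{NC}_{n+1})$ to the set of weakly properly ordered noncrossing hypertrees on $[n+1]$ that sends the simplex with chain $\hat 0=\pi_0<\dots<\pi_k=\hat 1$ to the hypertree whose hyperedges are the sets of elements moved by the individual nontrivial cycles of the labels $\sigma_1,\dots,\sigma_k$, ordered weakly by $f(e)=i$ when $e$ comes from a cycle of $\sigma_i$. Under this bijection, a simplex is a partition chamber if and only if its image is a properly ordered noncrossing tree; in particular, the partition chambers correspond bijectively to the properly ordered noncrossing trees on $[n+1]$. -/

import Mathlib

namespace Noncrossing

/-! ### Hypergraphs, hypertrees and trees -/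

/-- A simple cycle `(v₀, e₀, v₁, e₁, …, vₖ₋₁, eₖ₋₁, v₀)` of length `k = m + 2 ≥ 2`: the vertices
`v₀, …, vₖ₋₁` are distinct, the hyperedges are distinct, and `eᵢ` contains `vᵢ` and `vᵢ₊₁`,
the indices being taken modulo `k` (addition in `Fin k`). -/
def HasSimpleCycle {V : Type*} (H : Hypergraph V) : Prop :=
  ∃ (m : ℕ) (v : Fin (m + 2) → V) (e : Fin (m + 2) → Set V),
    Function.Injective v ∧ Function.Injective e ∧
      ∀ i, e i ∈ H.edgeSet ∧ v i ∈ e i ∧ v (i + 1) ∈ e i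

/-- Any two vertices are the endpoints of a path. -/
def IsConnected {V : Type*} (H : Hypergraph V) : Prop :=
  ∀ x ∈ H.vertexSet, ∀ y ∈ H.vertexSet, Relation.ReflTransGen H.Adj x y

/-- A hypertree is a connected hypergraph without simple cycles. -/
def IsHypertree {V : Type*} (H : Hypergraph V) : Prop :=
  IsConnected H ∧ ¬ HasSimpleCycle H

/-- A tree is a hypertree all of whose hyperedges have exactly two vertices. -/
def IsTree {V : Type*} (H : Hypergraph V) : Prop :=
  IsHypertree H ∧ ∀ e ∈ H.edgeSet, e.ncard = 2

/-- A hypergraph with vertex set the whole of `V` and hyperedges of size at least `2`, together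
with a weak linear ordering of its set of hyperedges. The weak linear ordering (a function from
the hyperedges to a linearly ordered set, up to having the same fibres in the same order) is
recorded as the total preorder `le` on the hyperedges that it induces: `le e e'` means
`f e ≤ f e'`. The field `mem_of_le` makes `le` a relation on the set of hyperedges only. -/
@[ext]
structure WeaklyOrderedHypergraph (V : Type*) extends Hypergraph V where
  vertexSet_eq : vertexSet = Set.univ
  nontrivial_of_mem : ∀ e ∈ edgeSet, e.Nontrivial
  le : Set V → Set V → Prop
  mem_of_le : ∀ e e', le e e' → e ∈ edgeSet ∧ e' ∈ edgeSet
  le_total : ∀ e ∈ edgeSet, ∀ e' ∈ edgeSet, le e e' ∨ le e' e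
  le_trans : ∀ e e' e'', le e e' → le e' e'' → le e e''

/-- The weak linear ordering is a (strict) linear ordering: no two distinct hyperedges are tied. -/
def WeaklyOrderedHypergraph.IsLinear {V : Type*} (τ : WeaklyOrderedHypergraph V) : Prop :=
  ∀ e e', τ.le e e' → τ.le e' e → e = e'

/-! ### Convex polygons and noncrossing hypergraphs -/

/-- Twice the signed area of the triangle `a b c` in the plane; it is negative exactly when
`a, b, c` are the corners of a nondegenerate triangle listed clockwise. -/
def orient (a b c : ℝ × ℝ) : ℝ :=
  (b.1 - a.1) * (c.2 - a.2) - (b.2 - a.2) * (c.1 - a.1)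

/-- The points `p 0, p 1, …, p n` are the distinct vertices of a convex polygon in the plane,
listed in the order of its clockwise oriented boundary. -/
def IsClockwisePolygon {n : ℕ} (p : Fin (n + 1) → ℝ × ℝ) : Prop :=
  Function.Injective p ∧ ∀ i j k, i < j → j < k → orient (p i) (p j) (p k) < 0

/-- The convex hull of a set of polygon vertices. -/
def hull {n : ℕ} (p : Fin (n + 1) → ℝ × ℝ) (e : Set (Fin (n + 1))) : Set (ℝ × ℝ) :=
  convexHull ℝ (p '' e)

/-- Two sets of polygon vertices are weakly noncrossing when their convex hulls have at most one
vertex, and no other points, in common. -/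
def WeaklyNoncrossing {n : ℕ} (p : Fin (n + 1) → ℝ × ℝ) (e e' : Set (Fin (n + 1))) : Prop :=
  hull p e ∩ hull p e' = ∅ ∨ ∃ v, hull p e ∩ hull p e' = {p v}

/-- The hyperedges are pairwise weakly noncrossing. -/
def IsNoncrossing {n : ℕ} (p : Fin (n + 1) → ℝ × ℝ) (H : Hypergraph (Fin (n + 1))) : Prop :=
  H.edgeSet.Pairwise (WeaklyNoncrossing p)

/-- `e` comes before `e'` in the local linear order at a common vertex `v`: looking from `p v`
towards the interior of the polygon, `e` is to the left of `e'`. -/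
def LeftOfAt {n : ℕ} (p : Fin (n + 1) → ℝ × ℝ) (v : Fin (n + 1)) (e e' : Set (Fin (n + 1))) :
    Prop :=
  v ∈ e ∧ v ∈ e' ∧ e ≠ e' ∧
    ∀ a ∈ e, a ≠ v → ∀ b ∈ e', b ≠ v → orient (p v) (p a) (p b) < 0

/-- The strict order of the hyperedge poset: the transitive closure of the local linear orders
at all vertices. -/
def HyperedgeLT {n : ℕ} (p : Fin (n + 1) → ℝ × ℝ) (H : Hypergraph (Fin (n + 1))) :
    Set (Fin (n + 1)) → Set (Fin (n + 1)) → Prop :=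
  Relation.TransGen fun e e' => e ∈ H.edgeSet ∧ e' ∈ H.edgeSet ∧ ∃ v, LeftOfAt p v e e'

/-- The weak ordering is a weak linear extension of the hyperedge poset: `e < e'` in the poset
implies `f e < f e'`. -/
def IsWeaklyProper {n : ℕ} (p : Fin (n + 1) → ℝ × ℝ) (τ : WeaklyOrderedHypergraph (Fin (n + 1))) :
    Prop :=
  ∀ e e', HyperedgeLT p τ.toHypergraph e e' → τ.le e e' ∧ ¬ τ.le e' e

/-- Weakly properly ordered noncrossing hypertrees on the vertices of the polygon `p`. -/
def WeaklyProperlyOrderedHypertree {n : ℕ} (p : Fin (n + 1) → ℝ × ℝ) : Type :=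
  {τ : WeaklyOrderedHypergraph (Fin (n + 1)) //
    IsHypertree τ.toHypergraph ∧ IsNoncrossing p τ.toHypergraph ∧ IsWeaklyProper p τ}

/-- A properly ordered noncrossing tree: the hypertree is a tree and the weak linear ordering is
a linear ordering, hence a linear extension of the hyperedge poset. -/
def WeaklyProperlyOrderedHypertree.IsProperlyOrderedTree {n : ℕ} {p : Fin (n + 1) → ℝ × ℝ}
    (τ : WeaklyProperlyOrderedHypertree p) : Prop :=
  IsTree τ.1.toHypergraph ∧ τ.1.IsLinear

/-! ### The noncrossing partition lattice and its link -/

/-- Noncrossing partitions of the vertices of the polygon: the convex hulls of distinct blocks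
are disjoint. They are ordered by refinement, as a subposet of the lattice of all partitions. -/
abbrev NCPartition {n : ℕ} (p : Fin (n + 1) → ℝ × ℝ) : Type :=
  {π : Setoid (Fin (n + 1)) //
    ∀ x y, ¬ π x y → Disjoint (hull p {z | π x z}) (hull p {z | π y z})}

/-- A simplex of the noncrossing partition link, that is, of the order complex of the noncrossing
partition lattice with both bounding elements removed: a finite chain of noncrossing partitions
other than the partition into singletons and the partition with one block. The empty chain is
the empty simplex, of dimension `-1`. -/
structure LinkSimplex {n : ℕ} (p : Fin (n + 1) → ℝ × ℝ) where
  verts : Finset (NCPartition p)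
  isChain : IsChain (· ≤ ·) (verts : Set (NCPartition p))
  ne_bot : ∀ π ∈ verts, π.1 ≠ ⊥
  ne_top : ∀ π ∈ verts, π.1 ≠ ⊤

/-- Partition chambers: the top-dimensional simplices of the link. -/
def LinkSimplex.IsChamber {n : ℕ} {p : Fin (n + 1) → ℝ × ℝ} (s : LinkSimplex p) : Prop :=
  ∀ t : LinkSimplex p, t.verts.card ≤ s.verts.card

/-- The elements of the chain between the bounding elements that is given by a simplex: the
vertices of the simplex and the two bounding elements. -/
def LinkSimplex.InChain {n : ℕ} {p : Fin (n + 1) → ℝ × ℝ} (s : LinkSimplex p)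
    (π : NCPartition p) : Prop :=
  π ∈ s.verts ∨ π.1 = ⊥ ∨ π.1 = ⊤

/-- `a < b` are adjacent elements of the chain between the bounding elements given by `s`. -/
def LinkSimplex.Step {n : ℕ} {p : Fin (n + 1) → ℝ × ℝ} (s : LinkSimplex p)
    (a b : NCPartition p) : Prop :=
  s.InChain a ∧ s.InChain b ∧ a < b ∧ ∀ c, s.InChain c → ¬ (a < c ∧ c < b)

/-! ### Noncrossing permutations and labels -/

/-- The permutation of a set of vertices `B`: the cycle through the elements of `B` in clockwise
(that is, increasing) order; it is the identity if `B` has at most one element. -/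
def cyclePerm {m : ℕ} (B : Finset (Fin m)) : Equiv.Perm (Fin m) :=
  (B.sort (· ≤ ·)).formPerm

theorem cyclePerm_mem {m : ℕ} {B : Finset (Fin m)} {x : Fin m} (h : x ∈ B) :
    cyclePerm B x ∈ B := by
  have := List.formPerm_apply_mem_of_mem (l := B.sort (· ≤ ·)) (x := x) (by simpa using h)
  exact (Finset.mem_sort _).1 this

theorem cyclePerm_symm_mem {m : ℕ} {B : Finset (Fin m)} {x : Fin m} (h : x ∈ B) :
    (cyclePerm B).symm x ∈ B := by
  have := (List.formPerm_mem_iff_mem (l := B.sort (· ≤ ·)) (x := (cyclePerm B).symm x)).1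
    (by
      show (cyclePerm B) ((cyclePerm B).symm x) ∈ B.sort (· ≤ ·)
      simpa using h)
  simpa using this

open Classical in
/-- The block of a partition that contains `x`. -/
noncomputable def block {m : ℕ} (π : Setoid (Fin m)) (x : Fin m) : Finset (Fin m) :=
  Finset.univ.filter fun y => π x y

theorem mem_block {m : ℕ} {π : Setoid (Fin m)} {x y : Fin m} : y ∈ block π x ↔ π x y := by
  simp [block]

theorem block_eq {m : ℕ} {π : Setoid (Fin m)} {x y : Fin m} (h : y ∈ block π x) :
    block π y = block π x := by
  ext z
  rw [mem_block] at h
  rw [mem_block, mem_block]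
  exact ⟨fun hz => π.trans' h hz, fun hz => π.trans' (π.symm' h) hz⟩

/-- The permutation of a partition: the product of the pairwise disjoint cycles of its blocks. -/
noncomputable def partitionPerm {m : ℕ} (π : Setoid (Fin m)) : Equiv.Perm (Fin m) where
  toFun x := cyclePerm (block π x) x
  invFun x := (cyclePerm (block π x)).symm x
  left_inv x := by
    have h := cyclePerm_mem (B := block π x) (mem_block.2 (π.refl' x))
    show (cyclePerm (block π (cyclePerm (block π x) x))).symm (cyclePerm (block π x) x) = x
    rw [block_eq h, Equiv.symm_apply_apply]
  right_inv x := by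
    have h := cyclePerm_symm_mem (B := block π x) (mem_block.2 (π.refl' x))
    show cyclePerm (block π ((cyclePerm (block π x)).symm x)) ((cyclePerm (block π x)).symm x) = x
    rw [block_eq h, Equiv.apply_symm_apply]

/-- The label of a pair `a < b` of noncrossing partitions: the permutation `σ` with `a σ = b`,
where products of permutations are read from left to right (first `a`, then `σ`). Since `*` on
`Equiv.Perm` is composition of functions, this is the equation `σ * a = b`. -/
noncomputable def label {n : ℕ} {p : Fin (n + 1) → ℝ × ℝ} (a b : NCPartition p) :
    Equiv.Perm (Fin (n + 1)) :=
  partitionPerm b.1 * (partitionPerm a.1)⁻¹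

/-- The hyperedges of the label of `a < b`: the sets of elements moved by the single
(nontrivial) cycles of the label. -/
def labelEdges {n : ℕ} {p : Fin (n + 1) → ℝ × ℝ} (a b : NCPartition p) :
    Set (Set (Fin (n + 1))) :=
  {e | ∃ g ∈ (label a b).cycleFactorsFinset, e = {x | g x ≠ x}}

/-- `τ` is the weakly ordered hypergraph read off from the labels of the chain `s`: its
hyperedges are the hyperedges of all the labels of adjacent pairs of the chain, and they are
weakly ordered by the position in the chain of the labels in which they occur. -/
def IsStandardName {n : ℕ} {p : Fin (n + 1) → ℝ × ℝ} (s : LinkSimplex p)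
    (τ : WeaklyOrderedHypergraph (Fin (n + 1))) : Prop :=
  (∀ e, e ∈ τ.edgeSet ↔ ∃ a b, s.Step a b ∧ e ∈ labelEdges a b) ∧
    ∀ a b a' b' e e', s.Step a b → s.Step a' b' → e ∈ labelEdges a b → e' ∈ labelEdges a' b' →
      (τ.le e e' ↔ a ≤ a')

end Noncrossing

/-! Everything rests on one combinatorial condition. A set `e` of vertices cuts the circle into
half-open arcs, its gaps, each running from an element of `e` up to, but excluding, the next one.
Distinct elements of `e` lie in different gaps (`eq_of_gap`). Two disjoint noncrossing hyperedges
lie in gaps of each other; if noncrossing hyperedges share a vertex, only the left one lies in a gap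
of the other. Hence the weakly properly ordered noncrossing hypertrees are the connected weakly
ordered hypergraphs in which `f ≤ e`, `f ≠ e` forces `f` into a single gap of `e`
(`weaklyProperlyOrderedHypertree_iff`). Acyclicity is then automatic: the latest hyperedge `e` of a
cycle would have two of its vertices joined inside one gap of `e`.

From chains to hypertrees: for `a < b` with label `σ` and `σ x ≠ x`, the arc from `x` to `σ x` is a
union of blocks of `a` and its interior is invariant under `σ`. So the blocks of `a`, and hence all
earlier hyperedges, as well as the other orbits of `σ`, lie in gaps of each orbit. The chain
generates the top partition through its labels, which gives connectedness.

From hypertrees to chains: the components of the initial segments of the ordering are noncrossing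
partitions (`comp_not_crosses`). Different segments give different partitions, because a hyperedge
`e` outside a segment `D` satisfies `comp D ≤ gap e`. The label between consecutive segments has
exactly the newly added hyperedges as nontrivial orbits (`labelOrbits_comp`), so the two
constructions are mutually inverse.

Chambers: the number of blocks drops strictly along a chain, so a chain has at most `n + 1`
elements, with equality when every step merges just two blocks. A step whose label has two orbits,
or an orbit with more than two elements, can be refined (`IsChamber.le_of_subset`). -/

namespace Noncrossing

/-! ### Cyclic intervals and gaps -/

/-- `z` lies in the open clockwise arc from `x` to `y`, which consists of all `z ≠ x` if
`x = y`. -/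
def Arc {m : ℕ} (x y z : Fin m) : Prop :=
  (x.val < y.val ∧ x.val < z.val ∧ z.val < y.val) ∨
    (y.val ≤ x.val ∧ (x.val < z.val ∨ z.val < y.val))

/-- `y` is the first element of `e` that comes strictly after `x` in clockwise order. -/
def IsNext {m : ℕ} (e : Set (Fin m)) (x y : Fin m) : Prop :=
  y ∈ e ∧ ∀ z ∈ e, ¬ Arc x y z

theorem exists_isNext {m : ℕ} {e : Set (Fin m)} (he : e.Nonempty) (x : Fin m) :
    ∃ y, IsNext e x y := by
  obtain ⟨y, hy, hmin⟩ := Set.exists_min_image e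
    -- Clockwise distance, up to a harmless shift. The vertex `x` itself gets the largest value `m`,
    -- a full turn, so it is chosen only if `e = {x}`.
    (fun y => if x.val < y.val then y.val - x.val - 1 else y.val + m - x.val) (Set.toFinite e) he
  refine ⟨y, hy, fun z hz h => ?_⟩
  have := hmin z hz
  have := x.isLt
  have := y.isLt
  have := z.isLt
  simp only [Arc] at *
  split_ifs at * <;> omega

theorem IsNext.unique {m : ℕ} {e : Set (Fin m)} {x y z : Fin m} (hy : IsNext e x y)
    (hz : IsNext e x z) : y = z := by
  have h1 := hy.2 z hz.1
  have h2 := hz.2 y hy.1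
  simp only [Arc, Fin.ext_iff] at *
  omega

/-- Two vertices are in the same gap of `e` if they are followed by the same element of `e`: the
gaps are the half-open cyclic intervals from one element of `e` to the next. -/
def gap {m : ℕ} (e : Set (Fin m)) : Setoid (Fin m) where
  r x x' := ∀ y, IsNext e x y ↔ IsNext e x' y
  iseqv := ⟨fun _ _ => Iff.rfl, fun h y => (h y).symm, fun h h' y => (h y).trans (h' y)⟩

theorem gap_of_isNext {m : ℕ} {e : Set (Fin m)} {x x' y : Fin m} (h : IsNext e x y)
    (h' : IsNext e x' y) : gap e x x' := fun _ =>
  ⟨fun hz => h.unique hz ▸ h', fun hz => h'.unique hz ▸ h⟩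

theorem eq_of_gap {m : ℕ} {e : Set (Fin m)} {x x' : Fin m} (hx : x ∈ e) (hx' : x' ∈ e)
    (h : gap e x x') : x = x' := by
  obtain ⟨y, hy⟩ := exists_isNext ⟨x, hx⟩ x
  have hy' := (h y).1 hy
  have h1 := hy.2 x hx
  have h2 := hy.2 x' hx'
  have h3 := hy'.2 x hx
  have h4 := hy'.2 x' hx'
  simp only [Arc, Fin.ext_iff] at *
  omega

/-- The set `f` lies in a single gap of `e`. -/
def InGap {m : ℕ} (f e : Set (Fin m)) : Prop :=
  ∀ x ∈ f, ∀ y ∈ f, gap e x y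

/-- Two sets of vertices cross if they contain the ends of two crossing chords. -/
def Crosses {m : ℕ} (X Y : Set (Fin m)) : Prop :=
  ∃ a b c d : Fin m, a < b ∧ b < c ∧ c < d ∧
    ((a ∈ X ∧ c ∈ X ∧ b ∈ Y ∧ d ∈ Y) ∨ (a ∈ Y ∧ c ∈ Y ∧ b ∈ X ∧ d ∈ X))

theorem Crosses.symm {m : ℕ} {X Y : Set (Fin m)} : Crosses X Y → Crosses Y X := by
  rintro ⟨a, b, c, d, h1, h2, h3, h4⟩
  exact ⟨a, b, c, d, h1, h2, h3, h4.symm⟩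

theorem Crosses.mono {m : ℕ} {X Y X' Y' : Set (Fin m)} (hX : X ⊆ X') (hY : Y ⊆ Y') :
    Crosses X Y → Crosses X' Y' := by
  rintro ⟨a, b, c, d, h1, h2, h3, h4⟩
  refine ⟨a, b, c, d, h1, h2, h3, h4.imp ?_ ?_⟩
  · exact fun h => ⟨hX h.1, hX h.2.1, hY h.2.2.1, hY h.2.2.2⟩
  · exact fun h => ⟨hY h.1, hY h.2.1, hX h.2.2.1, hX h.2.2.2⟩

theorem crosses_of_arc {m : ℕ} {X Y : Set (Fin m)} {a c b d : Fin m} (ha : a ∈ X) (hc : c ∈ X)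
    (hb : b ∈ Y) (hd : d ∈ Y) (hac : a ≠ c) (h : Arc a c b) (h' : Arc c a d) : Crosses X Y := by
  -- The linear order cuts the cyclic order `a, b, c, d` at one of four places.
  have : (a < b ∧ b < c ∧ c < d) ∨ (b < c ∧ c < d ∧ d < a) ∨ (c < d ∧ d < a ∧ a < b) ∨
      (d < a ∧ a < b ∧ b < c) := by
    simp only [Arc, Fin.ext_iff, Fin.lt_def, ne_eq] at *
    omega
  rcases this with h | h | h | h
  · exact ⟨a, b, c, d, h.1, h.2.1, h.2.2, Or.inl ⟨ha, hc, hb, hd⟩⟩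
  · exact ⟨b, c, d, a, h.1, h.2.1, h.2.2, Or.inr ⟨hb, hd, hc, ha⟩⟩
  · exact ⟨c, d, a, b, h.1, h.2.1, h.2.2, Or.inl ⟨hc, ha, hd, hb⟩⟩
  · exact ⟨d, a, b, c, h.1, h.2.1, h.2.2, Or.inr ⟨hd, hb, ha, hc⟩⟩

theorem InGap.not_crosses {m : ℕ} {f e : Set (Fin m)} (h : InGap f e) : ¬ Crosses f e := by
  rintro ⟨a, b, c, d, h1, h2, h3, ⟨ha, hc, hb, hd⟩ | ⟨ha, hc, hb, hd⟩⟩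
  · obtain ⟨y, hy⟩ := exists_isNext ⟨b, hb⟩ a
    have hy' := (h a ha c hc y).1 hy
    have h1 := hy.2 b hb
    have h2 := hy'.2 d hd
    simp only [Arc, Fin.lt_def] at *
    omega
  · obtain ⟨y, hy⟩ := exists_isNext ⟨c, hc⟩ b
    have hy' := (h b hb d hd y).1 hy
    have h1 := hy.2 c hc
    have h2 := hy'.2 a ha
    simp only [Arc, Fin.lt_def] at *
    omega

theorem InGap.eq_of_mem {m : ℕ} {f e : Set (Fin m)} (h : InGap f e) {x y : Fin m} (hx : x ∈ f)
    (hy : y ∈ f) (hx' : x ∈ e) (hy' : y ∈ e) : x = y :=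
  eq_of_gap hx' hy' (h x hx y hy)

/-- If `x` and `y` in `f` were followed by different elements `z` and `w` of `e`, the chord from `w`
to `z` would separate `x` from `y`. -/
theorem inGap_of_disjoint {m : ℕ} {f e : Set (Fin m)} (hd : Disjoint f e) (hc : ¬ Crosses f e) :
    InGap f e := by
  intro x hx y hy
  rcases e.eq_empty_or_nonempty with rfl | he
  · exact fun z => ⟨fun h => h.1.elim, fun h => h.1.elim⟩
  obtain ⟨z, hz⟩ := exists_isNext he x
  obtain ⟨w, hw⟩ := exists_isNext he y
  by_cases hzw : z = w
  · exact gap_of_isNext hz (hzw ▸ hw)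
  refine (hc (Crosses.symm (crosses_of_arc hw.1 hz.1 hx hy (Ne.symm hzw) ?_ ?_))).elim
  all_goals
    have h1 := hz.2 w hw.1
    have h2 := hw.2 z hz.1
    have h3 : x ≠ z := fun h => hd.le_bot ⟨hx, h ▸ hz.1⟩
    have h4 : x ≠ w := fun h => hd.le_bot ⟨hx, h ▸ hw.1⟩
    have h5 : y ≠ z := fun h => hd.le_bot ⟨hy, h ▸ hz.1⟩
    have h6 : y ≠ w := fun h => hd.le_bot ⟨hy, h ▸ hw.1⟩
    simp only [Arc, Fin.ext_iff, ne_eq] at *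
    omega

/-- If `v` is the only common vertex of `f` and `e` and `f` comes before `e` as seen from `v`,
then `f` lies in the gap of `e` that starts at `v`. -/
theorem inGap_of_arc {m : ℕ} {f e : Set (Fin m)} {v : Fin m} (hv : v ∈ e)
    (h : ∀ a ∈ f, a ≠ v → ∀ b ∈ e, b ≠ v → Arc v b a) : InGap f e := by
  obtain ⟨w, hw⟩ := exists_isNext ⟨v, hv⟩ v
  have key : ∀ a ∈ f, IsNext e a w := by
    refine fun a ha => ⟨hw.1, fun b hb hab => ?_⟩
    by_cases hav : a = v
    · exact hw.2 b hb (hav ▸ hab)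
    by_cases hbv : b = v
    · by_cases hwv : w = v
      · simp only [hwv, hbv, Arc, Fin.ext_iff] at *
        omega
      · have := h a ha hav w hw.1 hwv
        simp only [hbv, Arc, Fin.ext_iff] at *
        omega
    · have h1 := h a ha hav b hb hbv
      have h2 := hw.2 b hb
      have h4 := hw.2 v hv
      by_cases hwv : w = v
      · simp only [hwv, Arc, Fin.ext_iff] at *
        omega
      have h3 := h a ha hav w hw.1 hwv
      simp only [Arc, Fin.ext_iff] at *
      omega
  exact fun x hx y hy => gap_of_isNext (key x hx) (key y hy)

/-- Two sets that lie in a gap of each other are disjoint. -/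
theorem disjoint_of_inGap {m : ℕ} {f e : Set (Fin m)} (hf : f.Nontrivial) (he : e.Nontrivial)
    (h : InGap f e) (h' : InGap e f) : Disjoint f e := by
  rw [Set.disjoint_left]
  intro v hvf hve
  obtain ⟨a, ha, hav⟩ := hf.exists_ne v
  obtain ⟨b, hb, hbv⟩ := he.exists_ne v
  obtain ⟨w, hw⟩ := exists_isNext ⟨v, hve⟩ v
  obtain ⟨u, hu⟩ := exists_isNext ⟨v, hvf⟩ v
  -- Both gaps start at the common vertex `v`. Clockwise from `v`, this puts `a` before `b` and also
  -- `b` before `a`.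
  have hw' := (h v hvf a ha w).1 hw
  have hu' := (h' v hve b hb u).1 hu
  have h1 := hw.2 b hb
  have h2 := hw'.2 b hb
  have h3 := hu.2 a ha
  have h4 := hu'.2 a ha
  have h5 := hw'.2 v hve
  have h6 := hu'.2 v hvf
  simp only [Arc, Fin.ext_iff, ne_eq] at *
  omega

/-! ### Connected components -/

/-- The partition into connected components of the hypergraph with the given hyperedges. -/
def comp {V : Type*} (D : Set (Set V)) : Setoid V :=
  Relation.EqvGen.setoid fun x y => ∃ e ∈ D, x ∈ e ∧ y ∈ e

theorem comp_of_mem {V : Type*} {D : Set (Set V)} {e : Set V} (he : e ∈ D) {x y : V} (hx : x ∈ e)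
    (hy : y ∈ e) : comp D x y :=
  Relation.EqvGen.rel _ _ ⟨e, he, hx, hy⟩

theorem comp_le {V : Type*} {D : Set (Set V)} {r : Setoid V}
    (h : ∀ e ∈ D, ∀ x ∈ e, ∀ y ∈ e, r x y) : comp D ≤ r :=
  Setoid.eqvGen_le fun x y ⟨e, he, hx, hy⟩ => h e he x hx y hy

theorem comp_mono {V : Type*} {D D' : Set (Set V)} (h : D ⊆ D') : comp D ≤ comp D' :=
  comp_le fun _ he _ hx _ hy => comp_of_mem (h he) hx hy

/-- A set of vertices that is a union of connected components. -/
theorem comp_mem_iff {V : Type*} {D : Set (Set V)} (W : Set V)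
    (h : ∀ e ∈ D, ∀ x ∈ e, ∀ y ∈ e, x ∈ W → y ∈ W) {x y : V} (hxy : comp D x y) :
    x ∈ W ↔ y ∈ W :=
  comp_le (r := Setoid.ker (· ∈ W))
    (fun e he x hx y hy => propext ⟨h e he x hx y hy, h e he y hy x hx⟩) hxy |>.to_iff

/-- No chord of `C` separates two vertices in the same class; the ends of a chord are counted to
the outer side. -/
def side {m : ℕ} (C : Set (Fin m)) : Setoid (Fin m) where
  r x y := ∀ a ∈ C, ∀ c ∈ C, (a < x ∧ x < c) ↔ (a < y ∧ y < c)
  iseqv := ⟨fun _ _ _ _ _ => Iff.rfl, fun h a ha c hc => (h a ha c hc).symm,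
    fun h h' a ha c hc => (h a ha c hc).trans (h' a ha c hc)⟩

/-- Expresses noncrossing by an equivalence relation on vertices, so that it can be passed from
hyperedges to the components they generate. -/
theorem side_iff_not_crosses {m : ℕ} {C Y : Set (Fin m)} (hd : Disjoint C Y) :
    (∀ x ∈ Y, ∀ y ∈ Y, side C x y) ↔ ¬ Crosses C Y := by
  constructor
  · rintro h ⟨a, b, c, d, h1, h2, h3, ⟨ha, hc, hb, hd⟩ | ⟨ha, hc, hb, hd⟩⟩
    · have := h b hb d hd a ha c hc
      grind
    · have := h c hc a ha b hb d hd
      grind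
  · intro h x hx y hy
    have key : ∀ x ∈ Y, ∀ y ∈ Y, ∀ a ∈ C, ∀ c ∈ C, (a < x ∧ x < c) → (a < y ∧ y < c) := by
      intro x hx y hy a ha c hc hac
      by_contra hn
      have h3 : y ≠ a := fun h => hd.le_bot ⟨ha, h ▸ hy⟩
      have h4 : y ≠ c := fun h => hd.le_bot ⟨hc, h ▸ hy⟩
      refine h (crosses_of_arc ha hc hx hy (hac.1.trans hac.2).ne ?_ ?_)
      all_goals
        simp only [Arc, Fin.ext_iff, ne_eq, Fin.lt_def] at *
        omega
    exact fun a ha c hc => ⟨key x hx y hy a ha c hc, key y hy x hx a ha c hc⟩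

theorem comp_side {m : ℕ} {D : Set (Set (Fin m))} {C : Set (Fin m)} {x : Fin m}
    (h : ∀ g ∈ D, (∃ y ∈ g, comp D x y) → ∀ y ∈ g, ∀ z ∈ g, side C y z) {y z : Fin m}
    (hy : comp D x y) (hz : comp D x z) : side C y z := by
  -- Outside the component of `x` this relation only asks for connectedness, so hyperedges elsewhere
  -- need not respect `C`.
  let r : Setoid (Fin m) :=
    { r := fun y z => comp D y z ∧ (comp D x y → side C y z)
      iseqv := ⟨fun y => ⟨(comp D).refl' y, fun _ => (side C).refl' y⟩,
        fun h => ⟨(comp D).symm' h.1, fun hx => (side C).symm' (h.2 ((comp D).trans' hx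
          ((comp D).symm' h.1)))⟩,
        fun h h' => ⟨(comp D).trans' h.1 h'.1, fun hx => (side C).trans' (h.2 hx)
          (h'.2 ((comp D).trans' hx h.1))⟩⟩ }
  have hr : comp D ≤ r := comp_le fun g hg y hy z hz =>
    ⟨comp_of_mem hg hy hz, fun hx => h g hg ⟨y, hy, hx⟩ y hy z hz⟩
  exact (hr ((comp D).trans' ((comp D).symm' hy) hz)).2 hy

/-- The connected components of a noncrossing hypergraph do not cross. -/
theorem comp_not_crosses {m : ℕ} {D : Set (Set (Fin m))}
    (h : ∀ e ∈ D, ∀ f ∈ D, Disjoint e f → ¬ Crosses e f) {x y : Fin m} (hxy : ¬ comp D x y) :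
    ¬ Crosses {z | comp D x z} {z | comp D y z} := by
  have hdis : ∀ {g : Set (Fin m)} {x : Fin m}, g ∈ D → (¬ ∃ z ∈ g, comp D x z) →
      Disjoint {z | comp D x z} g := fun {g x} hg h =>
    Set.disjoint_left.2 fun z hz hzg => h ⟨z, hzg, hz⟩
  -- The passage from hyperedges to components is made twice: here a hyperedge is compared with the
  -- component of `x`, below that component with the one of `y`.
  have step : ∀ g ∈ D, (¬ ∃ z ∈ g, comp D x z) → ¬ Crosses {z | comp D x z} g := by
    intro g hg hgx hcr
    refine (side_iff_not_crosses (hdis hg hgx).symm).1 ?_ hcr.symm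
    intro y hy z hz
    refine comp_side (x := x) (fun g' hg' ⟨u, hu, hxu⟩ => ?_) hy hz
    have hd : Disjoint g g' := Set.disjoint_left.2 fun w hw hw' =>
      hgx ⟨w, hw, (comp D).trans' hxu (comp_of_mem hg' hu hw')⟩
    exact (side_iff_not_crosses hd).2 (h g hg g' hg' hd)
  have hd : Disjoint {z | comp D x z} {z | comp D y z} := Set.disjoint_left.2 fun z hz hz' =>
    hxy ((comp D).trans' hz ((comp D).symm' hz'))
  refine (side_iff_not_crosses hd).1 fun u hu v hv => ?_
  refine comp_side (x := y) (fun g hg ⟨w, hw, hyw⟩ => ?_) hu hv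
  have hgx : ¬ ∃ z ∈ g, comp D x z := fun ⟨z, hz, hxz⟩ =>
    hxy ((comp D).trans' hxz ((comp D).trans' (comp_of_mem hg hz hw) ((comp D).symm' hyw)))
  exact (side_iff_not_crosses (hdis hg hgx)).2 (step g hg hgx)

/-! ### The permutation of a partition -/

/-- The cycle moves one place along the sorted list, and the last element wraps around to the first;
`IsNext` covers both cases at once. -/
theorem isNext_cyclePerm {m : ℕ} {B : Finset (Fin m)} {x : Fin m} (hx : x ∈ B) :
    IsNext (B : Set (Fin m)) x (cyclePerm B x) := by
  refine ⟨cyclePerm_mem hx, fun z hz => ?_⟩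
  have hs : (B.sort (· ≤ ·)).SortedLT := B.sortedLT_sort
  obtain ⟨i, hi, rfl⟩ := List.getElem_of_mem ((B.mem_sort (· ≤ ·)).2 hx)
  obtain ⟨j, hj, rfl⟩ := List.getElem_of_mem ((B.mem_sort (· ≤ ·)).2 hz)
  have hmono : ∀ (i j : ℕ) (hi : i < (B.sort (· ≤ ·)).length) (hj : j < (B.sort (· ≤ ·)).length),
      i < j → ((B.sort (· ≤ ·))[i]).val < ((B.sort (· ≤ ·))[j]).val := fun i j hi hj hij =>
    hs.getElem_lt_getElem_of_lt hij
  have hmono' : ∀ (i j : ℕ) (hi : i < (B.sort (· ≤ ·)).length)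
      (hj : j < (B.sort (· ≤ ·)).length),
      i ≤ j → ((B.sort (· ≤ ·))[i]).val ≤ ((B.sort (· ≤ ·))[j]).val := by
    intro i j hi hj hij
    rcases hij.lt_or_eq with h | rfl
    · exact (hmono i j hi hj h).le
    · exact le_rfl
  rw [cyclePerm, List.formPerm_apply_getElem _ (B.sort_nodup _)]
  by_cases hlast : i + 1 < (B.sort (· ≤ ·)).length
  · simp only [Nat.mod_eq_of_lt hlast]
    have h1 := hmono i (i + 1) hi hlast (by omega)
    rcases le_or_gt j i with h | h
    · have := hmono' j i hj hi h
      simp only [Arc]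
      omega
    · have := hmono' (i + 1) j hlast hj h
      simp only [Arc]
      omega
  · have hl : i + 1 = (B.sort (· ≤ ·)).length := by omega
    simp only [hl, Nat.mod_self]
    have h1 := hmono' 0 j (by omega) hj (by omega)
    have h2 := hmono' j i hj hi (by omega)
    simp only [Arc]
    omega

theorem isNext_partitionPerm {m : ℕ} (π : Setoid (Fin m)) (x : Fin m) :
    IsNext {z | π x z} x (partitionPerm π x) := by
  have h := isNext_cyclePerm (B := block π x) (mem_block.2 (π.refl' x))
  have e : (block π x : Set (Fin m)) = {z | π x z} := Set.ext fun z => mem_block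
  rwa [e] at h

theorem rel_partitionPerm {m : ℕ} (π : Setoid (Fin m)) (x : Fin m) : π x (partitionPerm π x) :=
  (isNext_partitionPerm π x).1

theorem partitionPerm_eq {m : ℕ} {π : Setoid (Fin m)} {x y : Fin m}
    (h : IsNext {z | π x z} x y) : partitionPerm π x = y :=
  (isNext_partitionPerm π x).unique h

/-- The orbit of `v` cannot jump over `x`. If `σ u` is the first orbit point after `x`, then `u` is
not between `x` and `σ u`, and `x` is not between `u` and `σ u`, so `x` is `u` or `σ u`. -/
theorem sameCycle_of_isNext {m : ℕ} {σ : Equiv.Perm (Fin m)} {e : Set (Fin m)}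
    (h : ∀ v ∈ e, IsNext e v (σ v)) {v x : Fin m} (hv : v ∈ e) (hx : x ∈ e) : σ.SameCycle v x := by
  obtain ⟨y, hy⟩ := exists_isNext (e := {y | y ∈ e ∧ σ.SameCycle v y}) ⟨v, hv, .refl _ _⟩ x
  obtain ⟨u, rfl⟩ := σ.surjective y
  have hu : σ.SameCycle v u := Equiv.Perm.sameCycle_apply_right.1 hy.1.2
  have hue : u ∈ e := by
    obtain ⟨k, rfl⟩ := hu.exists_nat_pow_eq
    clear hu hy
    induction k with
    | zero => simpa using hv
    | succ k ih =>
      rw [pow_succ']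
      exact (h _ ih).1
  have hn := h _ hue
  have h1 := hn.2 x hx
  have h2 := hy.2 _ ⟨hue, hu⟩
  have h3 : x = σ u ∨ x = u := by
    simp only [Arc, Fin.ext_iff] at *
    omega
  rcases h3 with rfl | rfl
  · exact hy.1.2
  · exact hu

theorem sameCycle_partitionPerm {m : ℕ} {π : Setoid (Fin m)} {x y : Fin m} (h : π x y) :
    (partitionPerm π).SameCycle x y := by
  refine sameCycle_of_isNext (e := {z | π x z}) (fun v hv => ?_) (π.refl' x) h
  have e : {z | π x z} = {z | π v z} := Set.ext fun z =>
    ⟨fun hz => π.trans' (π.symm' hv) hz, fun hz => π.trans' hv hz⟩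
  exact e ▸ isNext_partitionPerm π v

/-! ### Orbits of the label of a pair of noncrossing partitions -/

/-- A partition is noncrossing if no two of its blocks cross. -/
def NonCrossingPartition {m : ℕ} (π : Setoid (Fin m)) : Prop :=
  ∀ x y, ¬ π x y → ¬ Crosses {z | π x z} {z | π y z}

/-- The label of a pair of partitions. -/
noncomputable def permLabel {m : ℕ} (a b : Setoid (Fin m)) : Equiv.Perm (Fin m) :=
  partitionPerm b * (partitionPerm a)⁻¹

theorem permLabel_apply {m : ℕ} (a b : Setoid (Fin m)) (x : Fin m) :
    permLabel a b (partitionPerm a x) = partitionPerm b x := by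
  simp [permLabel]

theorem rel_permLabel {m : ℕ} {a b : Setoid (Fin m)} (hab : a ≤ b) (x : Fin m) :
    b x (permLabel a b x) := by
  obtain ⟨y, rfl⟩ := (partitionPerm a).surjective x
  rw [permLabel_apply]
  exact b.trans' (hab (a.symm' (rel_partitionPerm a y))) (rel_partitionPerm b y)

/-- The half-open arc from `x` to its image under the label is a union of blocks of `a`. -/
theorem arc_permLabel_saturated {m : ℕ} {a b : Setoid (Fin m)} (ha : NonCrossingPartition a)
    (hb : NonCrossingPartition b) (hab : a ≤ b) {x z z' : Fin m} (hx : permLabel a b x ≠ x)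
    (hz : z = x ∨ Arc x (permLabel a b x) z) (hzz : a z z') :
    z' = x ∨ Arc x (permLabel a b x) z' := by
  have hbs : b x (permLabel a b x) := rel_permLabel hab x
  obtain ⟨y, rfl⟩ := (partitionPerm a).surjective x
  rw [permLabel_apply] at *
  have hA := isNext_partitionPerm a y
  have hB := isNext_partitionPerm b y
  set x := partitionPerm a y
  set s := partitionPerm b y
  by_contra hn
  have hbx : b y x := hab hA.1
  -- The arc from `x` to `s` runs through `y`. The `a`-block of `y` lies between `x` and `y`, and no
  -- element of its `b`-block lies strictly between `y` and `s`. A block leaving the arc would thus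
  -- cross the chord from `x` to `y` or the one from `x` to `s`.
  by_cases hzB : b y z
  · have hz'B : b y z' := b.trans' hzB (hab hzz)
    have h1 := hB.2 z hzB
    have h2 := hB.2 z' hz'B
    have h3 := hB.2 x hbx
    have h4 := hA.2 y (a.refl' y)
    by_cases hzA : a y z
    · have h5 := hA.2 z hzA
      have h6 := hA.2 z' (a.trans' hzA hzz)
      simp only [Arc, Fin.ext_iff, ne_eq] at *
      omega
    · have h5 : z ≠ x := fun h => hzA (h ▸ hA.1)
      have h6 : z ≠ y := fun h => hzA (h ▸ a.refl' y)
      have h7 : z' ≠ x := fun h => hzA (a.trans' (h ▸ hA.1) (a.symm' hzz))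
      have h8 : z' ≠ y := fun h => hzA (a.trans' (h ▸ a.refl' y) (a.symm' hzz))
      have h9 : x ≠ y := by
        simp only [Arc, Fin.ext_iff, ne_eq] at *
        omega
      refine ha y z hzA (crosses_of_arc (a := x) (c := y) (b := z) (d := z') hA.1 (a.refl' y)
        (a.refl' z) hzz h9 ?_ ?_)
      all_goals
        simp only [Arc, Fin.ext_iff, ne_eq] at *
        omega
  · have hz'B : ¬ b y z' := fun h => hzB (b.trans' h (b.symm' (hab hzz)))
    have h5 : z ≠ x := fun h => hzB (h ▸ hbx)
    have h7 : z' ≠ x := fun h => hz'B (h ▸ hbx)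
    have h8 : z' ≠ s := fun h => hz'B (h ▸ hB.1)
    refine hb y z hzB (crosses_of_arc (a := x) (c := s) (b := z) (d := z') hbx hB.1
        (b.refl' z) (hab hzz) (Ne.symm hx) ?_ ?_)
    all_goals
      simp only [Arc, Fin.ext_iff, ne_eq] at *
      omega

/-- The open arc from `x` to its image under the label is invariant under the label. -/
theorem arc_permLabel_invariant {m : ℕ} {a b : Setoid (Fin m)} (ha : NonCrossingPartition a)
    (hb : NonCrossingPartition b) (hab : a ≤ b) {x z : Fin m} (hx : permLabel a b x ≠ x)
    (hz : Arc x (permLabel a b x) z) :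
    Arc x (permLabel a b x) (permLabel a b z) := by
  have hbs : b x (permLabel a b x) := rel_permLabel hab x
  -- By injectivity the image of `z` is not the excluded endpoint of the arc.
  have hinj : permLabel a b z ≠ permLabel a b x := fun h => by
    rw [(permLabel a b).injective h] at hz
    simp only [Arc, Fin.ext_iff, ne_eq] at *
    omega
  obtain ⟨u, rfl⟩ := (partitionPerm a).surjective z
  have hu := arc_permLabel_saturated ha hb hab hx (Or.inr hz) (a.symm' (rel_partitionPerm a u))
  rw [permLabel_apply] at *
  have hB := isNext_partitionPerm b u
  by_cases huB : b x u
  · have h1 := hB.2 x (b.symm' huB)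
    have h2 := hB.2 (permLabel a b x) (b.trans' (b.symm' huB) hbs)
    simp only [Arc, Fin.ext_iff, ne_eq] at *
    omega
  · have h3 : u ≠ x := fun h => huB (h ▸ b.refl' _)
    have h4 : partitionPerm b u ≠ x := fun h => huB (b.symm' (h ▸ hB.1))
    by_contra hn
    refine hb x u huB (crosses_of_arc (a := x) (c := permLabel a b x) (b := u)
      (d := partitionPerm b u) (b.refl' x) hbs (b.refl' u) hB.1 (Ne.symm hx) ?_ ?_)
    all_goals
      simp only [Arc, Fin.ext_iff, ne_eq] at *
      omega

theorem arc_permLabel_sameCycle {m : ℕ} {a b : Setoid (Fin m)} (ha : NonCrossingPartition a)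
    (hb : NonCrossingPartition b) (hab : a ≤ b) {x z z' : Fin m} (hx : permLabel a b x ≠ x)
    (hz : Arc x (permLabel a b x) z) (hzz : (permLabel a b).SameCycle z z') :
    Arc x (permLabel a b x) z' := by
  obtain ⟨k, rfl⟩ := hzz.exists_nat_pow_eq
  clear hzz
  induction k with
  | zero => simpa using hz
  | succ k ih =>
    rw [pow_succ']
    exact arc_permLabel_invariant ha hb hab hx ih

/-- By invariance of the open arc, an orbit point inside it would trap the whole orbit there,
including `x`, which is not in it. -/
theorem isNext_permLabel {m : ℕ} {a b : Setoid (Fin m)} (ha : NonCrossingPartition a)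
    (hb : NonCrossingPartition b) (hab : a ≤ b) {x : Fin m} (hx : permLabel a b x ≠ x) :
    IsNext {z | (permLabel a b).SameCycle x z} x (permLabel a b x) := by
  refine ⟨Equiv.Perm.sameCycle_apply_right.2 (.refl _ _), fun z hz harc => ?_⟩
  have := arc_permLabel_sameCycle ha hb hab hx harc (Equiv.Perm.SameCycle.symm hz)
  simp only [Arc] at this
  omega

/-- Every vertex lies in a half-open arc from an element of a cycle of the label to its image. -/
theorem exists_arc_permLabel {m : ℕ} {a b : Setoid (Fin m)} {v : Fin m} (hv : permLabel a b v ≠ v)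
    (z : Fin m) : ∃ x, (permLabel a b).SameCycle v x ∧ permLabel a b x ≠ x ∧
      (z = x ∨ Arc x (permLabel a b x) z) := by
  obtain ⟨w, hw⟩ := exists_isNext (e := {y | (permLabel a b).SameCycle v y}) ⟨v, .refl _ _⟩ z
  obtain ⟨x, rfl⟩ := (permLabel a b).surjective w
  have hvx : (permLabel a b).SameCycle v x := Equiv.Perm.sameCycle_apply_right.1 hw.1
  have hx : permLabel a b x ≠ x := fun h => hv ((hvx.apply_eq_self_iff).2 h)
  refine ⟨x, hvx, hx, ?_⟩
  have h1 := hw.2 x hvx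
  simp only [Arc, Fin.ext_iff, ne_eq] at *
  omega

theorem isNext_of_arc_permLabel {m : ℕ} {a b : Setoid (Fin m)} (ha : NonCrossingPartition a)
    (hb : NonCrossingPartition b) (hab : a ≤ b) {v x z : Fin m}
    (hvx : (permLabel a b).SameCycle v x) (hx : permLabel a b x ≠ x)
    (hz : z = x ∨ Arc x (permLabel a b x) z) :
    IsNext {y | (permLabel a b).SameCycle v y} z (permLabel a b x) := by
  refine ⟨Equiv.Perm.sameCycle_apply_right.2 hvx, fun y hy harc => ?_⟩
  have h1 := (isNext_permLabel ha hb hab hx).2 y (hvx.symm.trans hy)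
  have h2 := (isNext_permLabel ha hb hab hx).2 x (.refl _ _)
  simp only [Arc, Fin.ext_iff, ne_eq] at *
  omega

/-- The blocks of `a` lie in single gaps of the cycles of the label. -/
theorem le_gap_permLabel {m : ℕ} {a b : Setoid (Fin m)} (ha : NonCrossingPartition a)
    (hb : NonCrossingPartition b) (hab : a ≤ b) {v : Fin m} (hv : permLabel a b v ≠ v) :
    a ≤ gap {y | (permLabel a b).SameCycle v y} := by
  intro z z' hzz
  obtain ⟨x, hvx, hx, hz⟩ := exists_arc_permLabel hv z
  exact gap_of_isNext (isNext_of_arc_permLabel ha hb hab hvx hx hz)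
    (isNext_of_arc_permLabel ha hb hab hvx hx (arc_permLabel_saturated ha hb hab hx hz hzz))

/-- Different cycles of the label lie in single gaps of each other. -/
theorem inGap_permLabel {m : ℕ} {a b : Setoid (Fin m)} (ha : NonCrossingPartition a)
    (hb : NonCrossingPartition b) (hab : a ≤ b) {v w : Fin m} (hv : permLabel a b v ≠ v)
    (hvw : ¬ (permLabel a b).SameCycle v w) :
    InGap {y | (permLabel a b).SameCycle w y} {y | (permLabel a b).SameCycle v y} := by
  intro z hz z' hz'
  obtain ⟨x, hvx, hx, hzx⟩ := exists_arc_permLabel hv z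
  have hzx' : Arc x (permLabel a b x) z := hzx.resolve_left fun h =>
    hvw (hvx.trans (h ▸ Equiv.Perm.SameCycle.symm hz))
  exact gap_of_isNext (isNext_of_arc_permLabel ha hb hab hvx hx hzx)
    (isNext_of_arc_permLabel ha hb hab hvx hx
      (Or.inr (arc_permLabel_sameCycle ha hb hab hx hzx'
        ((Equiv.Perm.SameCycle.symm hz).trans hz'))))

/-- The nontrivial orbits of the label. -/
def labelOrbits {m : ℕ} (a b : Setoid (Fin m)) : Set (Set (Fin m)) :=
  {e | ∃ v, permLabel a b v ≠ v ∧ e = {x | (permLabel a b).SameCycle v x}}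

theorem labelEdges_eq {n : ℕ} {p : Fin (n + 1) → ℝ × ℝ} (a b : NCPartition p) :
    labelEdges a b = labelOrbits a.1 b.1 := by
  have hl : label a b = permLabel a.1 b.1 := rfl
  ext e
  simp only [labelEdges, labelOrbits, Set.mem_ofPred_eq, hl]
  have key : ∀ v, permLabel a.1 b.1 v ≠ v →
      {x | (permLabel a.1 b.1).cycleOf v x ≠ x} = {x | (permLabel a.1 b.1).SameCycle v x} := by
    intro v hv
    ext x
    simp only [Set.mem_ofPred_eq, ← Equiv.Perm.mem_support]
    rw [Equiv.Perm.mem_support_cycleOf_iff]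
    exact ⟨fun h => h.1, fun h => ⟨h, Equiv.Perm.mem_support.2 hv⟩⟩
  constructor
  · rintro ⟨g, hg, rfl⟩
    obtain ⟨v, hv⟩ := (Equiv.Perm.mem_cycleFactorsFinset_iff.1 hg).1.nonempty_support
    have hgv := Equiv.Perm.cycle_is_cycleOf hv hg
    have hv' := Equiv.Perm.mem_support.1 (Equiv.Perm.mem_cycleFactorsFinset_support_le hg hv)
    exact ⟨v, hv', by rw [hgv, key v hv']⟩
  · rintro ⟨v, hv, rfl⟩
    exact ⟨_, Equiv.Perm.cycleOf_mem_cycleFactorsFinset_iff.2 (Equiv.Perm.mem_support.2 hv),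
      (key v hv).symm⟩

theorem labelOrbits_nontrivial {m : ℕ} {a b : Setoid (Fin m)} {e : Set (Fin m)}
    (he : e ∈ labelOrbits a b) : e.Nontrivial := by
  obtain ⟨v, hv, rfl⟩ := he
  exact ⟨v, .refl _ _, _, Equiv.Perm.sameCycle_apply_right.2 (.refl _ _), hv.symm⟩

theorem rel_of_mem_labelOrbits {m : ℕ} {a b : Setoid (Fin m)} (hab : a ≤ b) {e : Set (Fin m)}
    (he : e ∈ labelOrbits a b) {x y : Fin m} (hx : x ∈ e) (hy : y ∈ e) : b x y := by
  obtain ⟨v, hv, rfl⟩ := he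
  obtain ⟨k, rfl⟩ := Equiv.Perm.SameCycle.exists_nat_pow_eq
    ((Equiv.Perm.SameCycle.symm hx).trans hy)
  clear hy
  induction k with
  | zero => exact b.refl' _
  | succ k ih =>
    rw [pow_succ']
    exact b.trans' ih (rel_permLabel hab _)

theorem inGap_of_rel {m : ℕ} {a b : Setoid (Fin m)} (ha : NonCrossingPartition a)
    (hb : NonCrossingPartition b) (hab : a ≤ b) {e f : Set (Fin m)} (he : e ∈ labelOrbits a b)
    (hf : ∀ x ∈ f, ∀ y ∈ f, a x y) : InGap f e := by
  obtain ⟨v, hv, rfl⟩ := he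
  exact fun x hx y hy => le_gap_permLabel ha hb hab hv (hf x hx y hy)

theorem inGap_of_mem_labelOrbits {m : ℕ} {a b : Setoid (Fin m)} (ha : NonCrossingPartition a)
    (hb : NonCrossingPartition b) (hab : a ≤ b) {e f : Set (Fin m)} (he : e ∈ labelOrbits a b)
    (hf : f ∈ labelOrbits a b) (hne : f ≠ e) : InGap f e := by
  obtain ⟨v, hv, rfl⟩ := he
  obtain ⟨w, hw, rfl⟩ := hf
  refine inGap_permLabel ha hb hab hv fun h => hne ?_
  ext z
  exact ⟨fun hz => h.trans hz, fun hz => h.symm.trans hz⟩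

/-- The larger partition is generated by the smaller one and the orbits of the label. -/
theorem le_of_labelOrbits {m : ℕ} {a b c : Setoid (Fin m)} (hac : a ≤ c)
    (h : ∀ e ∈ labelOrbits a b, ∀ x ∈ e, ∀ y ∈ e, c x y) : b ≤ c := by
  intro x y hxy
  obtain ⟨k, rfl⟩ := (sameCycle_partitionPerm hxy).exists_nat_pow_eq
  clear hxy
  induction k with
  | zero => exact c.refl' _
  | succ k ih =>
    rw [pow_succ']
    refine c.trans' ih ?_
    rw [Equiv.Perm.mul_apply]
    generalize (partitionPerm b ^ k) x = u
    -- Applying `b` means applying `a` and then the label: the first move stays in a block of `a`,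
    -- the second in an orbit of the label.
    have h1 : c u (partitionPerm a u) := hac (rel_partitionPerm a u)
    rw [← permLabel_apply a b u]
    by_cases hv : permLabel a b (partitionPerm a u) = partitionPerm a u
    · rwa [hv]
    · exact c.trans' h1 (h _ ⟨_, hv, rfl⟩ _ (.refl _ _) _
        (Equiv.Perm.sameCycle_apply_right.2 (.refl _ _)))

/-! ### Labels of partitions into connected components -/

theorem IsNext.ne_of_nontrivial {m : ℕ} {e : Set (Fin m)} {v w : Fin m} (h : IsNext e v w)
    (he : e.Nontrivial) : w ≠ v := by
  rintro rfl
  obtain ⟨x, hx, hxw⟩ := he.exists_ne w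
  have := h.2 x hx
  simp only [Arc, Fin.ext_iff, ne_eq] at *
  omega

/-- The open arc from `x` to `v` is a union of components of `D ∪ E`. A hyperedge of `D` leaving it
would cross the chord from `x` to `v`. For `g ∈ E`, `x` and `v` lie in the same gap of `g`, so the
arc contains all of `g` or nothing of it. -/
theorem partitionPerm_comp_of_notMem {m : ℕ} {D E : Set (Set (Fin m))}
    (hnc : NonCrossingPartition (comp D)) (hDE : ∀ e ∈ E, ∀ f ∈ D, InGap f e) {x v : Fin m}
    (hx : IsNext {z | comp D x z} x v) (hv : ∀ e ∈ E, v ∉ e) :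
    partitionPerm (comp (D ∪ E)) x = v := by
  refine partitionPerm_eq ⟨comp_mono Set.subset_union_left hx.1, fun z hz harc => ?_⟩
  have hxx : ¬ Arc x v x := by simp only [Arc]; omega
  refine hxx ((comp_mem_iff {z | Arc x v z} ?_ hz).2 harc)
  intro g hg z hz z' hz' h
  by_contra hn
  simp only [Set.mem_ofPred_eq] at h hn
  rcases hg with hg | hg
  · have hzz : comp D z z' := comp_of_mem hg hz hz'
    by_cases hxz : comp D x z
    · exact hx.2 z hxz h
    have h1 : z' ≠ x := fun h => hxz ((comp D).symm' (h ▸ hzz))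
    have h2 : z' ≠ v := fun h => hxz ((comp D).trans' (h ▸ hx.1) ((comp D).symm' hzz))
    have h3 : z ≠ x := fun h => hxz (h ▸ (comp D).refl' x)
    have h4 : z ≠ v := fun h => hxz (h ▸ hx.1)
    refine hnc x z hxz (crosses_of_arc (a := x) (c := v) (b := z) (d := z')
      ((comp D).refl' x) hx.1 ((comp D).refl' z) hzz ?_ ?_ ?_)
    all_goals
      simp only [Arc, Fin.ext_iff, ne_eq] at *
      omega
  · obtain ⟨u, hu⟩ := exists_isNext ⟨z, hz⟩ x
    have hu' := (comp_le (hDE g hg) hx.1 u).1 hu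
    have h1 := hu.2 z hz
    have h2 := hu'.2 z' hz'
    have h3 : z ≠ v := fun h => hv g hg (h ▸ hz)
    have h4 : z' ≠ v := fun h => hv g hg (h ▸ hz')
    have h5 := hu.2 z' hz'
    have h6 := hu'.2 z hz
    have h7 : u ≠ v := fun h => hv g hg (h ▸ hu.1)
    simp only [Arc, Fin.ext_iff, ne_eq] at *
    omega

/-- As `x` and `v` lie in the same gap of `e`, `w` also follows `x` in `e`, and the open arc from
`x` to `w` lies in the gap of `e` that starts at `v`. Every hyperedge other than `e` that meets the
arc stays in this gap; leaving the arc, it would separate `x` from `v`. -/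
theorem partitionPerm_comp_of_mem {m : ℕ} {D E : Set (Set (Fin m))}
    (hnt : ∀ e ∈ E, e.Nontrivial) (hnc : NonCrossingPartition (comp D))
    (hDE : ∀ e ∈ E, ∀ f ∈ D, InGap f e) (hEE : ∀ e ∈ E, ∀ f ∈ E, f ≠ e → InGap f e)
    {x v w : Fin m} {e : Set (Fin m)} (hx : IsNext {z | comp D x z} x v) (he : e ∈ E)
    (hv : v ∈ e) (hw : IsNext e v w) : partitionPerm (comp (D ∪ E)) x = w := by
  have hwx : IsNext e x w := (comp_le (hDE e he) hx.1 w).2 hw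
  have hwv := hw.ne_of_nontrivial (hnt e he)
  refine partitionPerm_eq ⟨(comp _).trans' (comp_mono Set.subset_union_left hx.1)
    (comp_of_mem (Set.mem_union_right _ he) hv hw.1), fun z hz harc => ?_⟩
  have hxx : ¬ Arc x w x := by simp only [Arc]; omega
  refine hxx ((comp_mem_iff {z | Arc x w z} ?_ hz).2 harc)
  have hz_next : ∀ z, Arc x w z → IsNext e z w := by
    refine fun z hz => ⟨hw.1, fun y hy hyz => hwx.2 y hy ?_⟩
    have := hwx.2 y hy
    simp only [Arc, Fin.ext_iff, ne_eq] at *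
    omega
  have hvw := hwx.2 v hv
  intro g hg z hz z' hz' h
  by_contra hn
  simp only [Set.mem_ofPred_eq] at h hn
  rcases hg with hg | hg
  · have hzz : comp D z z' := comp_of_mem hg hz hz'
    by_cases hxz : comp D x z
    · have := hx.2 z hxz
      simp only [Arc, Fin.ext_iff, ne_eq] at *
      omega
    have h1 : z' ≠ x := fun h => hxz ((comp D).symm' (h ▸ hzz))
    have h2 : z' ≠ v := fun h => hxz ((comp D).trans' (h ▸ hx.1) ((comp D).symm' hzz))
    have h3 : z ≠ x := fun h => hxz (h ▸ (comp D).refl' x)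
    have h4 : z ≠ v := fun h => hxz (h ▸ hx.1)
    have h5 := ((comp_le (hDE e he) hzz w).1 (hz_next z h)).2 v hv
    refine hnc x z hxz (crosses_of_arc (a := x) (c := v) (b := z) (d := z')
      ((comp D).refl' x) hx.1 ((comp D).refl' z) hzz ?_ ?_ ?_)
    all_goals
      simp only [Arc, Fin.ext_iff, ne_eq] at *
      omega
  · by_cases hge : g = e
    · subst hge
      exact hwx.2 z hz h
    have hvg : v ∉ g := fun hvg => Set.disjoint_left.1 (disjoint_of_inGap (hnt g hg) (hnt e he)
      (hEE e he g hg hge) (hEE g hg e he (Ne.symm hge))) hvg hv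
    obtain ⟨u, hu⟩ := exists_isNext ⟨z, hz⟩ x
    have hu' := (comp_le (hDE g hg) hx.1 u).1 hu
    have h1 := hu.2 z hz
    have h2 := hu'.2 z' hz'
    have h3 : z ≠ v := fun h => hvg (h ▸ hz)
    have h4 : z' ≠ v := fun h => hvg (h ▸ hz')
    have h5 := ((hEE e he g hg hge z hz z' hz' w).1 (hz_next z h)).2 v hv
    have h6 := hu'.2 z hz
    have h7 : u ≠ v := fun h => hvg (h ▸ hu.1)
    have h8 := hu.2 z' hz'
    simp only [Arc, Fin.ext_iff, ne_eq] at *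
    omega

/-- If the hyperedges in `E` are pairwise disjoint and come after those in `D`, then they are the
orbits of the label that joins the components of `D` to those of `D ∪ E`. -/
theorem labelOrbits_comp {m : ℕ} {D E : Set (Set (Fin m))}
    (hnt : ∀ e ∈ E, e.Nontrivial) (hnc : NonCrossingPartition (comp D))
    (hDE : ∀ e ∈ E, ∀ f ∈ D, InGap f e) (hEE : ∀ e ∈ E, ∀ f ∈ E, f ≠ e → InGap f e) :
    labelOrbits (comp D) (comp (D ∪ E)) = E := by
  set σ := permLabel (comp D) (comp (D ∪ E)) with hσ
  have h1 : ∀ v, (∀ e ∈ E, v ∉ e) → σ v = v := by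
    intro v hv
    obtain ⟨x, rfl⟩ := (partitionPerm (comp D)).surjective v
    rw [hσ, permLabel_apply]
    exact partitionPerm_comp_of_notMem hnc hDE (isNext_partitionPerm _ x) hv
  have h2 : ∀ e ∈ E, ∀ v ∈ e, IsNext e v (σ v) := by
    intro e he v hv
    obtain ⟨w, hw⟩ := exists_isNext ⟨v, hv⟩ v
    obtain ⟨x, rfl⟩ := (partitionPerm (comp D)).surjective v
    rw [hσ, permLabel_apply,
      partitionPerm_comp_of_mem hnt hnc hDE hEE (isNext_partitionPerm _ x) he hv hw]
    exact hw
  have h3 : ∀ e ∈ E, ∀ v ∈ e, e = {x | σ.SameCycle v x} := by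
    intro e he v hv
    ext x
    refine ⟨fun hx => sameCycle_of_isNext (h2 e he) hv hx, fun hx => ?_⟩
    obtain ⟨k, rfl⟩ := Equiv.Perm.SameCycle.exists_nat_pow_eq hx
    clear hx
    induction k with
    | zero => simpa using hv
    | succ k ih =>
      rw [pow_succ']
      exact (h2 e he _ ih).1
  ext e
  constructor
  · rintro ⟨v, hv, rfl⟩
    by_contra hn
    refine hv (h1 v fun e he hve => hn ?_)
    have := h3 e he v hve
    rwa [← hσ, ← this]
  · intro he
    obtain ⟨v, hv⟩ := (hnt e he).nonempty
    exact ⟨v, (h2 e he v hv).ne_of_nontrivial (hnt e he), h3 e he v hv⟩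

/-! ### Convex polygons -/

theorem orient_rotate (a b c : ℝ × ℝ) : orient a b c = orient b c a := by
  simp only [orient]; ring

theorem orient_swap (a b c : ℝ × ℝ) : orient a c b = -orient a b c := by
  simp only [orient]; ring

/-- The orientation is negative exactly when `a`, `b`, `c` are in clockwise order. -/
theorem orient_neg_iff {n : ℕ} {p : Fin (n + 1) → ℝ × ℝ} (hp : IsClockwisePolygon p)
    {a b c : Fin (n + 1)} :
    orient (p a) (p b) (p c) < 0 ↔ (a < b ∧ b < c) ∨ (b < c ∧ c < a) ∨ (c < a ∧ a < b) := by
  have key : ∀ a b c : Fin (n + 1), (a < b ∧ b < c) ∨ (b < c ∧ c < a) ∨ (c < a ∧ a < b) →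
      orient (p a) (p b) (p c) < 0 := by
    rintro a b c (h | h | h)
    · exact hp.2 a b c h.1 h.2
    · rw [orient_rotate]
      exact hp.2 b c a h.1 h.2
    · rw [← orient_rotate]
      exact hp.2 c a b h.1 h.2
  refine ⟨fun h => ?_, key a b c⟩
  by_contra hn
  have hd : (a = b ∨ b = c ∨ a = c) ∨
      ((a < c ∧ c < b) ∨ (c < b ∧ b < a) ∨ (b < a ∧ a < c)) := by
    simp only [Fin.ext_iff, Fin.lt_def] at *
    omega
  rcases hd with (rfl | rfl | rfl) | hd
  · simp [orient] at h
  · have : orient (p a) (p b) (p b) = 0 := by simp only [orient]; ring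
    linarith
  · simp [orient] at h
  · have := key a c b hd
    rw [orient_swap] at this
    linarith

theorem orient_eq_zero {n : ℕ} {p : Fin (n + 1) → ℝ × ℝ} (hp : IsClockwisePolygon p)
    {a b c : Fin (n + 1)} (h : orient (p a) (p b) (p c) = 0) : a = b ∨ b = c ∨ a = c := by
  have h1 := (orient_neg_iff hp (a := a) (b := b) (c := c)).not.1 (by rw [h]; exact lt_irrefl _)
  have h2 := (orient_neg_iff hp (a := a) (b := c) (c := b)).not.1
    (by rw [orient_swap, h]; simp)
  simp only [Fin.ext_iff, Fin.lt_def] at *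
  omega

/-- The diagonals of a convex quadrilateral intersect. -/
theorem exists_mem_segments {n : ℕ} {p : Fin (n + 1) → ℝ × ℝ} (hp : IsClockwisePolygon p)
    {a b c d : Fin (n + 1)} (hab : a < b) (hbc : b < c) (hcd : c < d) :
    ∃ q, q ∈ segment ℝ (p a) (p c) ∧ q ∈ segment ℝ (p b) (p d) := by
  have h1 := hp.2 b c d hbc hcd
  have h2 := hp.2 a c d (hab.trans hbc) hcd
  have h3 := hp.2 a b d hab (hbc.trans hcd)
  have h4 := hp.2 a b c hab hbc
  set A := orient (p b) (p c) (p d) with hA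
  set B := orient (p a) (p c) (p d) with hB
  set C := orient (p a) (p b) (p d) with hC
  set E := orient (p a) (p b) (p c) with hE
  -- Either diagonal splits the quadrilateral into two triangles, so the sums of signed areas agree.
  -- The intersection point divides each diagonal in the ratio of the triangles cut off by the other
  -- one. All four areas are negative.
  have hs : A + C = B + E := by
    simp only [hA, hB, hC, hE, orient]; ring
  have hs0 : A + C ≠ 0 := by linarith
  refine ⟨(A / (A + C)) • p a + (C / (A + C)) • p c,
    ⟨A / (A + C), C / (A + C), div_nonneg_of_nonpos h1.le (by linarith),
      div_nonneg_of_nonpos h3.le (by linarith), by field_simp, rfl⟩,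
    ⟨B / (A + C), E / (A + C), div_nonneg_of_nonpos h2.le (by linarith),
      div_nonneg_of_nonpos h4.le (by linarith), by rw [← add_div, ← hs, div_self hs0], ?_⟩⟩
  ext
  · simp only [Prod.fst_add, Prod.smul_fst, smul_eq_mul]
    field_simp
    simp only [hA, hB, hC, hE, orient]; ring
  · simp only [Prod.snd_add, Prod.smul_snd, smul_eq_mul]
    field_simp
    simp only [hA, hB, hC, hE, orient]; ring

theorem orient_eq_zero_of_mem_segment {a b q : ℝ × ℝ} (h : q ∈ segment ℝ a b) :
    orient a b q = 0 := by
  obtain ⟨s, t, -, -, hst, rfl⟩ := h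
  simp only [orient, Prod.fst_add, Prod.smul_fst, smul_eq_mul, Prod.snd_add, Prod.smul_snd]
  obtain rfl : s = 1 - t := by linarith
  ring

theorem segment_subset_hull {n : ℕ} (p : Fin (n + 1) → ℝ × ℝ) {e : Set (Fin (n + 1))}
    {a b : Fin (n + 1)} (ha : a ∈ e) (hb : b ∈ e) : segment ℝ (p a) (p b) ⊆ hull p e :=
  (convex_convexHull ℝ _).segment_subset (subset_convexHull ℝ _ (Set.mem_image_of_mem p ha))
    (subset_convexHull ℝ _ (Set.mem_image_of_mem p hb))

theorem mem_hull {n : ℕ} (p : Fin (n + 1) → ℝ × ℝ) {e : Set (Fin (n + 1))}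
    {a : Fin (n + 1)} (ha : a ∈ e) : p a ∈ hull p e :=
  subset_convexHull ℝ _ (Set.mem_image_of_mem p ha)

/-- Crossing sets of vertices have intersecting hulls; the intersection contains a point other
than a vertex. -/
theorem exists_mem_hulls_of_crosses {n : ℕ} {p : Fin (n + 1) → ℝ × ℝ} (hp : IsClockwisePolygon p)
    {e f : Set (Fin (n + 1))} (h : Crosses e f) :
    ∃ q ∈ hull p e ∩ hull p f, ∀ v, q ≠ p v := by
  obtain ⟨a, b, c, d, h1, h2, h3, h4⟩ := h
  obtain ⟨q, hq1, hq2⟩ := exists_mem_segments hp h1 h2 h3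
  refine ⟨q, ?_, ?_⟩
  · rcases h4 with ⟨ha, hc, hb, hd⟩ | ⟨ha, hc, hb, hd⟩
    · exact ⟨segment_subset_hull p ha hc hq1, segment_subset_hull p hb hd hq2⟩
    · exact ⟨segment_subset_hull p hb hd hq2, segment_subset_hull p ha hc hq1⟩
  · rintro v rfl
    have h5 := orient_eq_zero hp (orient_eq_zero_of_mem_segment hq1)
    have h6 := orient_eq_zero hp (orient_eq_zero_of_mem_segment hq2)
    simp only [Fin.ext_iff, Fin.lt_def] at *
    omega

theorem WeaklyNoncrossing.not_crosses {n : ℕ} {p : Fin (n + 1) → ℝ × ℝ}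
    (hp : IsClockwisePolygon p) {e f : Set (Fin (n + 1))} (h : WeaklyNoncrossing p e f) :
    ¬ Crosses e f := by
  intro hc
  obtain ⟨q, hq, hqv⟩ := exists_mem_hulls_of_crosses hp hc
  rcases h with h | ⟨v, h⟩
  · rw [h] at hq
    exact hq
  · rw [h] at hq
    exact hqv v hq

theorem WeaklyNoncrossing.eq_of_mem {n : ℕ} {p : Fin (n + 1) → ℝ × ℝ}
    (hp : IsClockwisePolygon p) {e f : Set (Fin (n + 1))} (h : WeaklyNoncrossing p e f)
    {x y : Fin (n + 1)} (hxe : x ∈ e) (hxf : x ∈ f) (hye : y ∈ e) (hyf : y ∈ f) : x = y := by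
  have hx : p x ∈ hull p e ∩ hull p f := ⟨mem_hull p hxe, mem_hull p hxf⟩
  have hy : p y ∈ hull p e ∩ hull p f := ⟨mem_hull p hye, mem_hull p hyf⟩
  rcases h with h | ⟨v, h⟩
  · rw [h] at hx
    exact hx.elim
  · rw [h] at hx hy
    exact hp.1 (Eq.trans hx (Eq.symm hy))

theorem orient_add_smul (v w x y : ℝ × ℝ) {s t : ℝ} (hst : s + t = 1) :
    orient v w (s • x + t • y) = s * orient v w x + t * orient v w y := by
  simp only [orient, Prod.fst_add, Prod.smul_fst, smul_eq_mul, Prod.snd_add, Prod.smul_snd]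
  obtain rfl : s = 1 - t := by linarith
  ring

theorem convex_orient_nonpos (v w : ℝ × ℝ) : Convex ℝ {x | orient v w x ≤ 0} := by
  intro x hx y hy s t hs ht hst
  simp only [Set.mem_ofPred_eq] at *
  rw [orient_add_smul _ _ _ _ hst]
  nlinarith

theorem convex_orient_pos (v w : ℝ × ℝ) : Convex ℝ {x | 0 < orient v w x} := by
  intro x hx y hy s t hs ht hst
  simp only [Set.mem_ofPred_eq] at *
  rw [orient_add_smul _ _ _ _ hst]
  rcases hs.eq_or_lt with rfl | hs
  · rw [zero_add] at hst
    subst hst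
    linarith
  · nlinarith [mul_pos hs hx]

/-- A segment from `v` to a point of the open half-plane leaves the boundary line at once, so one
boundary point may be added. This handles hulls that touch at a common vertex. -/
theorem convex_orient_pos_insert (v w : ℝ × ℝ) : Convex ℝ {x | 0 < orient v w x ∨ x = v} := by
  have hv : orient v w v = 0 := by simp [orient]
  have hnn : ∀ x, 0 < orient v w x ∨ x = v → 0 ≤ orient v w x := by
    rintro x (h | rfl)
    · exact h.le
    · exact hv.ge
  intro x hx y hy s t hs ht hst
  rcases hs.eq_or_lt with rfl | hs
  · rw [zero_add] at hst
    subst hst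
    simpa using hy
  rcases ht.eq_or_lt with rfl | ht
  · rw [add_zero] at hst
    subst hst
    simpa using hx
  simp only [Set.mem_ofPred_eq] at *
  rw [orient_add_smul _ _ _ _ hst]
  have h1 := hnn x hx
  have h2 := hnn y hy
  rcases hx with hx | rfl
  · left
    nlinarith [mul_pos hs hx, mul_nonneg ht.le h2]
  rcases hy with hy | rfl
  · left
    nlinarith [mul_pos ht hy]
  · right
    rw [← add_smul, hst, one_smul]

/-- If `f` lies in a gap of `e`, then their hulls are separated by a line. -/
theorem InGap.hull_inter {n : ℕ} {p : Fin (n + 1) → ℝ × ℝ} (hp : IsClockwisePolygon p)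
    {e f : Set (Fin (n + 1))} (he : e.Nontrivial) (h : InGap f e) :
    (Disjoint f e → hull p f ∩ hull p e = ∅) ∧ ∀ v ∈ f, v ∈ e → hull p f ∩ hull p e = {p v} := by
  rcases f.eq_empty_or_nonempty with rfl | ⟨u, hu⟩
  · simp [hull]
  obtain ⟨w, hw⟩ := exists_isNext he.nonempty u
  -- The separating line goes through `p v` and `p w`, the ends of the gap of `e` that contains `f`;
  -- `v` is the preimage of `w` under the cycle of `e`.
  obtain ⟨v, hv, hvw⟩ : ∃ v ∈ e, IsNext e v w := by
    have := isNext_cyclePerm (B := e.toFinite.toFinset)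
      (x := (cyclePerm e.toFinite.toFinset).symm w)
      (cyclePerm_symm_mem (by simpa using hw.1))
    rw [Equiv.apply_symm_apply] at this
    refine ⟨(cyclePerm e.toFinite.toFinset).symm w, ?_, by simpa using this⟩
    simpa using cyclePerm_symm_mem (B := e.toFinite.toFinset) (x := w) (by simpa using hw.1)
  have hwv := hvw.ne_of_nontrivial he
  have hf : ∀ x ∈ f, x = v ∨ 0 < orient (p v) (p w) (p x) := by
    intro x hx
    have hx' := (h u hu x hx w).1 hw
    have h1 := hx'.2 v hv
    have h2 := hx'.2 w hw.1
    by_cases hxv : x = v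
    · exact Or.inl hxv
    refine Or.inr ?_
    rw [← neg_neg (orient (p v) (p w) (p x)), ← orient_swap, neg_pos, orient_neg_iff hp]
    simp only [Arc, Fin.ext_iff, Fin.lt_def, ne_eq] at *
    omega
  have hE : ∀ x ∈ e, orient (p v) (p w) (p x) ≤ 0 := by
    intro x hx
    by_contra hn
    rw [not_le, ← neg_neg (orient (p v) (p w) (p x)), ← orient_swap, neg_pos,
      orient_neg_iff hp] at hn
    have h1 := hvw.2 x hx
    simp only [Arc, Fin.ext_iff, Fin.lt_def, ne_eq] at *
    omega
  have hEh : hull p e ⊆ {x | orient (p v) (p w) x ≤ 0} := by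
    refine convexHull_min ?_ (convex_orient_nonpos _ _)
    rintro _ ⟨x, hx, rfl⟩
    exact hE x hx
  constructor
  · intro hd
    have hFh : hull p f ⊆ {x | 0 < orient (p v) (p w) x} := by
      refine convexHull_min ?_ (convex_orient_pos _ _)
      rintro _ ⟨x, hx, rfl⟩
      exact (hf x hx).resolve_left fun h => hd.le_bot ⟨hx, h ▸ hv⟩
    ext x
    simp only [Set.mem_inter_iff, Set.mem_empty_iff_false, iff_false]
    rintro ⟨hxf, hxe⟩
    have h1 : 0 < orient (p v) (p w) x := hFh hxf
    have h2 : orient (p v) (p w) x ≤ 0 := hEh hxe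
    linarith
  · intro v' hv'f hv'e
    have hFh : hull p f ⊆ {x | 0 < orient (p v) (p w) x ∨ x = p v} := by
      refine convexHull_min ?_ (convex_orient_pos_insert _ _)
      rintro _ ⟨x, hx, rfl⟩
      exact (hf x hx).symm.imp_right (congrArg p)
    have hvv : v' = v := (hf v' hv'f).resolve_right (not_lt.2 (hE v' hv'e))
    subst hvv
    ext x
    simp only [Set.mem_inter_iff, Set.mem_singleton_iff]
    refine ⟨fun hx => (hFh hx.1).resolve_left (not_lt.2 (hEh hx.2)), ?_⟩
    rintro rfl
    exact ⟨mem_hull p hv'f, mem_hull p hv'e⟩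

theorem WeaklyNoncrossing.symm {n : ℕ} {p : Fin (n + 1) → ℝ × ℝ} {e f : Set (Fin (n + 1))}
    (h : WeaklyNoncrossing p e f) : WeaklyNoncrossing p f e := by
  rwa [WeaklyNoncrossing, Set.inter_comm]

theorem InGap.weaklyNoncrossing {n : ℕ} {p : Fin (n + 1) → ℝ × ℝ} (hp : IsClockwisePolygon p)
    {e f : Set (Fin (n + 1))} (he : e.Nontrivial) (h : InGap f e) : WeaklyNoncrossing p f e := by
  by_cases hd : Disjoint f e
  · exact Or.inl ((h.hull_inter hp he).1 hd)
  · obtain ⟨v, hvf, hve⟩ := Set.not_disjoint_iff.1 hd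
    exact Or.inr ⟨v, (h.hull_inter hp he).2 v hvf hve⟩

theorem disjoint_hull_iff {n : ℕ} {p : Fin (n + 1) → ℝ × ℝ} (hp : IsClockwisePolygon p)
    {e f : Set (Fin (n + 1))} (hd : Disjoint e f) :
    Disjoint (hull p e) (hull p f) ↔ ¬ Crosses e f := by
  constructor
  · intro h hc
    obtain ⟨q, hq, -⟩ := exists_mem_hulls_of_crosses hp hc
    exact h.le_bot hq
  · intro h
    rw [Set.disjoint_iff_inter_eq_empty]
    by_cases hf : f.Nontrivial
    · exact ((inGap_of_disjoint hd h).hull_inter hp hf).1 hd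
    by_cases he : e.Nontrivial
    · rw [Set.inter_comm]
      exact ((inGap_of_disjoint hd.symm fun hc => h hc.symm).hull_inter hp he).1 hd.symm
    rw [Set.not_nontrivial_iff] at he hf
    rcases he.eq_empty_or_singleton with rfl | ⟨x, rfl⟩
    · simp [hull]
    rcases hf.eq_empty_or_singleton with rfl | ⟨y, rfl⟩
    · simp [hull]
    · have hxy : x ≠ y := by simpa using hd
      simp [hull, hp.1.ne hxy.symm]

theorem nonCrossingPartition_iff {n : ℕ} {p : Fin (n + 1) → ℝ × ℝ} (hp : IsClockwisePolygon p)
    (π : Setoid (Fin (n + 1))) :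
    (∀ x y, ¬ π x y → Disjoint (hull p {z | π x z}) (hull p {z | π y z})) ↔
      NonCrossingPartition π := by
  refine forall_congr' fun x => forall_congr' fun y => forall_congr' fun hxy => ?_
  exact disjoint_hull_iff hp
    (Set.disjoint_left.2 fun z hz hz' => hxy (π.trans' hz (π.symm' hz')))

theorem leftOfAt_iff {n : ℕ} {p : Fin (n + 1) → ℝ × ℝ} (hp : IsClockwisePolygon p)
    {v : Fin (n + 1)} {e f : Set (Fin (n + 1))} :
    LeftOfAt p v e f ↔ v ∈ e ∧ v ∈ f ∧ e ≠ f ∧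
      ∀ a ∈ e, a ≠ v → ∀ b ∈ f, b ≠ v → Arc v b a := by
  have h0 : ∀ a b : Fin (n + 1), a ≠ v → b ≠ v →
      (orient (p v) (p a) (p b) < 0 ↔ Arc v b a) := by
    intro a b ha hb
    rw [orient_neg_iff hp]
    simp only [Arc, Fin.ext_iff, Fin.lt_def, ne_eq] at *
    omega
  unfold LeftOfAt
  refine and_congr_right fun _ => and_congr_right fun _ => and_congr_right fun _ => ?_
  exact forall_congr' fun a => forall_congr' fun ha => forall_congr' fun hav => forall_congr'
    fun b => forall_congr' fun hb => forall_congr' fun hbv => h0 a b hav hbv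

/-! ### Weakly properly ordered noncrossing hypertrees -/

/-- Every hyperedge lies in a single gap of every other hyperedge that is not before it. -/
def WeaklyOrderedHypergraph.IsGapOrdered {m : ℕ} (τ : WeaklyOrderedHypergraph (Fin m)) : Prop :=
  ∀ e ∈ τ.edgeSet, ∀ f ∈ τ.edgeSet, f ≠ e → τ.le f e → InGap f e

theorem isConnected_iff {V : Type*} {τ : WeaklyOrderedHypergraph V} :
    IsConnected τ.toHypergraph ↔ comp τ.edgeSet = ⊤ := by
  constructor
  · intro h
    refine eq_top_iff.2 fun x y _ => ?_
    have hxy := h x (τ.vertexSet_eq ▸ Set.mem_univ x) y (τ.vertexSet_eq ▸ Set.mem_univ y)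
    clear * - hxy
    induction hxy with
    | refl => exact (comp _).refl' x
    | tail _ h ih =>
      obtain ⟨e, he, hx, hy⟩ := h
      exact (comp _).trans' ih (comp_of_mem he hx hy)
  · intro h x _ y _
    have hxy : comp τ.edgeSet x y := h ▸ trivial
    let r : Setoid V :=
      { r := Relation.ReflTransGen τ.Adj
        iseqv := ⟨fun _ => .refl,
          fun {x y} h => by
            induction h with
            | refl => exact .refl
            | tail _ h ih => exact (Relation.ReflTransGen.single h.symm).trans ih,
          fun h h' => h.trans h'⟩ }
    exact comp_le (r := r) (fun e he x hx y hy => .single ⟨e, he, hx, hy⟩) hxy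

/-- Let `e i` be a latest hyperedge of the cycle. All others lie in gaps of `e i`, so going from `v
(i + 1)` around to `v i` along them stays in one gap, although these are distinct elements of `e i`.
-/
theorem not_hasSimpleCycle {m : ℕ} {τ : WeaklyOrderedHypergraph (Fin m)} (h : τ.IsGapOrdered) :
    ¬ HasSimpleCycle τ.toHypergraph := by
  rintro ⟨k, v, e, hv, he, hve⟩
  obtain ⟨i, hi⟩ : ∃ i, ∀ j, τ.le (e j) (e i) := by
    have : ∀ s : Finset (Fin (k + 2)), s.Nonempty → ∃ i ∈ s, ∀ j ∈ s, τ.le (e j) (e i) := by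
      intro s hs
      induction hs using Finset.Nonempty.cons_induction with
      | singleton a =>
        exact ⟨a, by simp, fun j hj => by
          rw [Finset.mem_singleton.1 hj]
          exact (or_self_iff).1 (τ.le_total _ (hve a).1 _ (hve a).1)⟩
      | cons a s _ _ ih =>
        obtain ⟨i, his, hi⟩ := ih
        have haa := (or_self_iff).1 (τ.le_total _ (hve a).1 _ (hve a).1)
        rcases τ.le_total _ (hve a).1 _ (hve i).1 with h | h
        · refine ⟨i, by simp [his], fun j hj => ?_⟩
          rcases Finset.mem_cons.1 hj with rfl | hj
          · exact h
          · exact hi j hj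
        · refine ⟨a, by simp, fun j hj => ?_⟩
          rcases Finset.mem_cons.1 hj with rfl | hj
          · exact haa
          · exact τ.le_trans _ _ _ (hi j hj) h
    obtain ⟨i, -, hi⟩ := this Finset.univ Finset.univ_nonempty
    exact ⟨i, fun j => hi j (Finset.mem_univ j)⟩
  -- Here `j` counts the hyperedges passed after `v (i + 1)`; at `j = k + 1` the walk has used all
  -- except `e i` and arrives at `v i`.
  have hgap : ∀ j : ℕ, j < k + 2 → gap (e i) (v (i + 1)) (v (i + 1 + Fin.ofNat (k + 2) j)) := by
    intro j
    induction j with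
    | zero =>
      intro _
      have : Fin.ofNat (k + 2) 0 = 0 := rfl
      rw [this, add_zero]
    | succ j ih =>
      intro hj
      refine (gap _).trans' (ih (by omega)) ?_
      set l := i + 1 + Fin.ofNat (k + 2) j with hl
      have hsucc : i + 1 + Fin.ofNat (k + 2) (j + 1) = l + 1 := by
        rw [hl, add_assoc _ _ (1 : Fin (k + 2))]
        congr 1
        ext
        simp [Fin.val_add, Fin.ofNat]
      rw [hsucc]
      have hli : l ≠ i := by
        intro h
        rw [hl, add_assoc, add_eq_left] at h
        have := congrArg Fin.val h
        simp only [Fin.val_add, Fin.ofNat, Fin.val_one, Fin.val_zero] at this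
        rw [Nat.add_mod_mod, Nat.mod_eq_of_lt (by omega)] at this
        omega
      exact h _ (hve i).1 _ (hve l).1 (he.ne hli) (hi l) _ (hve l).2.1 _ (hve l).2.2
  have hlast : i + 1 + Fin.ofNat (k + 2) (k + 1) = i := by
    rw [add_assoc, add_eq_left]
    ext
    simp [Fin.val_add, Fin.ofNat, Nat.add_comm 1]
  have := hgap (k + 1) (by omega)
  rw [hlast] at this
  have h1 := hv (eq_of_gap (hve i).2.2 (hve i).2.1 this)
  rw [add_eq_left] at h1
  exact absurd (congrArg Fin.val h1) (by simp)

theorem isNoncrossing_of_isGapOrdered {n : ℕ} {p : Fin (n + 1) → ℝ × ℝ}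
    (hp : IsClockwisePolygon p) {τ : WeaklyOrderedHypergraph (Fin (n + 1))}
    (h : τ.IsGapOrdered) : IsNoncrossing p τ.toHypergraph := by
  intro e he f hf hne
  rcases τ.le_total e he f hf with hle | hle
  · exact (h f hf e he hne hle).weaklyNoncrossing hp (τ.nontrivial_of_mem f hf)
  · exact ((h e he f hf hne.symm hle).weaklyNoncrossing hp (τ.nontrivial_of_mem e he)).symm

/-- Any other vertex `a` of `e` lies between `v` and any other vertex `b` of `f`, so `v` and `b` are
in different gaps of `e`. -/
theorem not_inGap_of_leftOfAt {n : ℕ} {p : Fin (n + 1) → ℝ × ℝ}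
    (hp : IsClockwisePolygon p) {v : Fin (n + 1)} {e f : Set (Fin (n + 1))}
    (he : e.Nontrivial) (hf : f.Nontrivial) (h : LeftOfAt p v e f) : ¬ InGap f e := by
  intro hg
  obtain ⟨hve, hvf, -, h⟩ := (leftOfAt_iff hp).1 h
  obtain ⟨a, ha, hav⟩ := he.exists_ne v
  obtain ⟨b, hb, hbv⟩ := hf.exists_ne v
  obtain ⟨w, hw⟩ := exists_isNext ⟨v, hve⟩ v
  have hw' := (hg v hvf b hb w).1 hw
  have h1 := h a ha hav b hb hbv
  have h2 := hw.2 a ha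
  have h3 := hw'.2 a ha
  have h4 := hw'.2 v hve
  simp only [Arc, Fin.ext_iff, ne_eq] at *
  omega

theorem isWeaklyProper_of_isGapOrdered {n : ℕ} {p : Fin (n + 1) → ℝ × ℝ}
    (hp : IsClockwisePolygon p) {τ : WeaklyOrderedHypergraph (Fin (n + 1))}
    (h : τ.IsGapOrdered) : IsWeaklyProper p τ := by
  have step : ∀ e f, (e ∈ τ.edgeSet ∧ f ∈ τ.edgeSet ∧ ∃ v, LeftOfAt p v e f) →
      τ.le e f ∧ ¬ τ.le f e := by
    rintro e f ⟨he, hf, v, hv⟩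
    have hn : ¬ τ.le f e := fun hle => not_inGap_of_leftOfAt hp (τ.nontrivial_of_mem e he)
      (τ.nontrivial_of_mem f hf) hv (h e he f hf hv.2.2.1.symm hle)
    exact ⟨(τ.le_total e he f hf).resolve_right hn, hn⟩
  intro e f hef
  induction hef with
  | single h => exact step _ _ h
  | tail _ h ih =>
    have := step _ _ h
    exact ⟨τ.le_trans _ _ _ ih.1 this.1, fun hle => ih.2 (τ.le_trans _ _ _ this.1 hle)⟩

/-- If both fail, then clockwise from `v` some `b ∈ f` precedes some `a ∈ e`, and some `a' ∈ e`
precedes some `b' ∈ f`. Comparing `a'` with `b` yields a pattern `e, f, e` or `f, e, f`, in which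
the chord from `v` to the middle vertex crosses the chord of the outer two. -/
theorem leftOfAt_or {n : ℕ} {p : Fin (n + 1) → ℝ × ℝ} (hp : IsClockwisePolygon p)
    {v : Fin (n + 1)} {e f : Set (Fin (n + 1))} (h : WeaklyNoncrossing p e f) (hne : e ≠ f)
    (he : v ∈ e) (hf : v ∈ f) : LeftOfAt p v e f ∨ LeftOfAt p v f e := by
  by_contra! hn
  obtain ⟨hn1, hn2⟩ := hn
  rw [leftOfAt_iff hp] at hn1 hn2
  push Not at hn1 hn2
  obtain ⟨a, ha, hav, b, hb, hbv, hab⟩ := hn1 he hf hne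
  obtain ⟨b', hb', hbv', a', ha', hav', hab'⟩ := hn2 hf he hne.symm
  have hnc := h.not_crosses hp
  have hd : ∀ a ∈ e, a ≠ v → ∀ b ∈ f, b ≠ v → a ≠ b := fun a ha hav b hb hbv hab =>
    hav (h.eq_of_mem hp ha (hab ▸ hb) he hf)
  have hord : ∀ a ∈ e, a ≠ v → ∀ a' ∈ e, a' ≠ v → ∀ b ∈ f, b ≠ v → ¬ (Arc v b a ∧ Arc v a' b) := by
    intro a ha hav a' ha' hav' b hb hbv ⟨h1, h2⟩
    refine hnc (Crosses.symm (crosses_of_arc (a := v) (c := b) (b := a) (d := a') hf hb ha ha'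
      hbv.symm h1 ?_))
    simp only [Arc, Fin.ext_iff, ne_eq] at *
    omega
  have hord' : ∀ b ∈ f, b ≠ v → ∀ b' ∈ f, b' ≠ v → ∀ a ∈ e, a ≠ v →
      ¬ (Arc v a b ∧ Arc v b' a) := by
    intro b hb hbv b' hb' hbv' a ha hav ⟨h1, h2⟩
    refine hnc (crosses_of_arc (a := v) (c := a) (b := b) (d := b') he ha hb hb' hav.symm h1 ?_)
    simp only [Arc, Fin.ext_iff, ne_eq] at *
    omega
  have key : ∀ x y : Fin (n + 1), x ≠ v → y ≠ v → x ≠ y → ¬ Arc v y x → Arc v x y := by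
    intro x y hx hy hxy h
    simp only [Arc, Fin.ext_iff, ne_eq] at *
    omega
  have h1 := key a b hav hbv (hd a ha hav b hb hbv) hab
  have h2 := key b' a' hbv' hav' (hd a' ha' hav' b' hb' hbv').symm hab'
  by_cases h3 : Arc v b a'
  · exact hord a' ha' hav' a ha hav b hb hbv ⟨h3, h1⟩
  · exact hord' b hb hbv b' hb' hbv' a' ha' hav'
      ⟨key a' b hav' hbv (hd a' ha' hav' b hb hbv) h3, h2⟩

theorem isGapOrdered_of_isWeaklyProper {n : ℕ} {p : Fin (n + 1) → ℝ × ℝ}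
    (hp : IsClockwisePolygon p) {τ : WeaklyOrderedHypergraph (Fin (n + 1))}
    (hnc : IsNoncrossing p τ.toHypergraph) (hw : IsWeaklyProper p τ) : τ.IsGapOrdered := by
  intro e he f hf hne hle
  have hfe := hnc hf he hne
  by_cases hd : Disjoint f e
  · exact inGap_of_disjoint hd (hfe.not_crosses hp)
  obtain ⟨v, hvf, hve⟩ := Set.not_disjoint_iff.1 hd
  rcases leftOfAt_or hp hfe hne hvf hve with h | h
  · exact inGap_of_arc hve ((leftOfAt_iff hp).1 h).2.2.2
  · exact absurd hle (hw e f (.single ⟨he, hf, v, h⟩)).2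

/-- Removes the geometry from the target of the bijection: only connectedness and the gap condition
are used afterwards. -/
theorem weaklyProperlyOrderedHypertree_iff {n : ℕ} {p : Fin (n + 1) → ℝ × ℝ}
    (hp : IsClockwisePolygon p) {τ : WeaklyOrderedHypergraph (Fin (n + 1))} :
    (IsHypertree τ.toHypergraph ∧ IsNoncrossing p τ.toHypergraph ∧ IsWeaklyProper p τ) ↔
      comp τ.edgeSet = ⊤ ∧ τ.IsGapOrdered := by
  constructor
  · exact fun ⟨h1, h2, h3⟩ => ⟨isConnected_iff.1 h1.1, isGapOrdered_of_isWeaklyProper hp h2 h3⟩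
  · exact fun ⟨h1, h2⟩ => ⟨⟨isConnected_iff.2 h1, not_hasSimpleCycle h2⟩,
      isNoncrossing_of_isGapOrdered hp h2, isWeaklyProper_of_isGapOrdered hp h2⟩

/-! ### Chains of noncrossing partitions -/

theorem NCPartition.nonCrossing {n : ℕ} {p : Fin (n + 1) → ℝ × ℝ} (hp : IsClockwisePolygon p)
    (c : NCPartition p) : NonCrossingPartition c.1 :=
  (nonCrossingPartition_iff hp c.1).1 c.2

theorem exists_eq_bot {n : ℕ} {p : Fin (n + 1) → ℝ × ℝ} (hp : IsClockwisePolygon p) :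
    ∃ c : NCPartition p, c.1 = ⊥ := by
  refine ⟨⟨⊥, (nonCrossingPartition_iff hp ⊥).2 ?_⟩, rfl⟩
  rintro x y - ⟨a, b, c, d, h1, h2, h3, ⟨ha, hc, hb, hd⟩ | ⟨ha, hc, hb, hd⟩⟩
  · exact absurd (h1.trans h2) ((show x = a from ha) ▸ (show x = c from hc) ▸ lt_irrefl _)
  · exact absurd (h1.trans h2) ((show y = a from ha) ▸ (show y = c from hc) ▸ lt_irrefl _)

theorem exists_eq_top {n : ℕ} (p : Fin (n + 1) → ℝ × ℝ) : ∃ c : NCPartition p, c.1 = ⊤ :=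
  ⟨⟨⊤, fun _ _ h => (h trivial).elim⟩, rfl⟩

instance {n : ℕ} {p : Fin (n + 1) → ℝ × ℝ} : Finite (NCPartition p) := by
  have : Finite (Setoid (Fin (n + 1))) :=
    Finite.of_injective (fun s : Setoid (Fin (n + 1)) => s.r) fun s t h =>
      Setoid.ext fun x y => iff_of_eq (congrFun (congrFun h x) y)
  infer_instance

namespace LinkSimplex

variable {n : ℕ} {p : Fin (n + 1) → ℝ × ℝ}

theorem InChain.total {s : LinkSimplex p} {c d : NCPartition p} (hc : s.InChain c)
    (hd : s.InChain d) : c ≤ d ∨ d ≤ c := by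
  rcases hc with hc | hc | hc
  · rcases hd with hd | hd | hd
    · exact s.isChain.total hc hd
    · exact Or.inr (show d.1 ≤ c.1 from hd ▸ bot_le)
    · exact Or.inl (show c.1 ≤ d.1 from hd ▸ le_top)
  · exact Or.inl (show c.1 ≤ d.1 from hc ▸ bot_le)
  · exact Or.inr (show d.1 ≤ c.1 from hc ▸ le_top)

theorem exists_step {s : LinkSimplex p} (hp : IsClockwisePolygon p) {c : NCPartition p}
    (hc : s.InChain c) (h : c.1 ≠ ⊥) : ∃ a, s.Step a c := by
  obtain ⟨b, hb⟩ := exists_eq_bot hp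
  have hbc : b < c := lt_of_le_of_ne (show b.1 ≤ c.1 from hb ▸ bot_le) fun hbc => h (hbc ▸ hb)
  obtain ⟨a, ha⟩ := (Set.toFinite {a | s.InChain a ∧ a < c}).exists_maximal
    ⟨b, Or.inr (Or.inl hb), hbc⟩
  exact ⟨a, ha.1.1, hc, ha.1.2, fun d hd had =>
    absurd (ha.2 ⟨hd, had.2⟩ had.1.le) (not_le_of_gt had.1)⟩

theorem Step.le_of_lt {s : LinkSimplex p} {a b c : NCPartition p} (h : s.Step a b)
    (hc : s.InChain c) (hac : a < c) : b ≤ c := by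
  rcases h.2.1.total hc with hle | hle
  · exact hle
  · rcases hle.lt_or_eq with hlt | rfl
    · exact (h.2.2.2 c hc ⟨hac, hlt⟩).elim
    · exact le_rfl

theorem Step.lt {s : LinkSimplex p} {a b : NCPartition p} (h : s.Step a b) : a < b := h.2.2.1

theorem Step.le {s : LinkSimplex p} {a b : NCPartition p} (h : s.Step a b) : a.1 ≤ b.1 :=
  h.lt.le

theorem Step.unique {s : LinkSimplex p} {a b b' : NCPartition p} (h : s.Step a b)
    (h' : s.Step a b') : b = b' :=
  le_antisymm (h.le_of_lt h'.2.1 h'.lt) (h'.le_of_lt h.2.1 h.lt)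

/-- Since `b ≤ a'`, the orbit `f` lies in one block of `a'`, and blocks of `a'` lie in gaps of the
orbits of the next label. -/
theorem Step.inGap {s : LinkSimplex p} (hp : IsClockwisePolygon p) {a b a' b' : NCPartition p}
    (h : s.Step a b) (h' : s.Step a' b') {e f : Set (Fin (n + 1))}
    (hf : f ∈ labelOrbits a.1 b.1) (he : e ∈ labelOrbits a'.1 b'.1) (haa : a < a') :
    InGap f e :=
  inGap_of_rel (a'.nonCrossing hp) (b'.nonCrossing hp) h'.le he
    fun _ hx _ hy => h.le_of_lt h'.1 haa (rel_of_mem_labelOrbits h.le hf hx hy)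

theorem Step.inGap_of_le {s : LinkSimplex p} (hp : IsClockwisePolygon p)
    {a b a' b' : NCPartition p}
    (h : s.Step a b) (h' : s.Step a' b') {e f : Set (Fin (n + 1))}
    (hf : f ∈ labelOrbits a.1 b.1) (he : e ∈ labelOrbits a'.1 b'.1) (hne : f ≠ e) (haa : a ≤ a') :
    InGap f e := by
  rcases haa.lt_or_eq with hlt | rfl
  · exact h.inGap hp h' hf he hlt
  · obtain rfl := h.unique h'
    exact inGap_of_mem_labelOrbits (a.nonCrossing hp) (b.nonCrossing hp) h.le he hf hne

theorem not_inGap_self {m : ℕ} {e : Set (Fin m)} (he : e.Nontrivial) : ¬ InGap e e := by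
  obtain ⟨x, hx, y, hy, hxy⟩ := he
  exact fun h => hxy (h.eq_of_mem hx hy hx hy)

/-- A hyperedge occurs in the label of only one step of a chain. -/
theorem Step.eq_of_mem {s : LinkSimplex p} (hp : IsClockwisePolygon p) {a b a' b' : NCPartition p}
    (h : s.Step a b) (h' : s.Step a' b') {e : Set (Fin (n + 1))}
    (he : e ∈ labelOrbits a.1 b.1) (he' : e ∈ labelOrbits a'.1 b'.1) : a = a' := by
  by_contra hne
  rcases h.1.total h'.1 with hle | hle
  · exact not_inGap_self (labelOrbits_nontrivial he)
      (h.inGap hp h' he he' (lt_of_le_of_ne hle hne))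
  · exact not_inGap_self (labelOrbits_nontrivial he)
      (h'.inGap hp h he' he (lt_of_le_of_ne hle (Ne.symm hne)))

/-- The elements of a chain are generated by the hyperedges of the labels below them. -/
theorem InChain.eq_comp {s : LinkSimplex p} (hp : IsClockwisePolygon p) {c : NCPartition p}
    (hc : s.InChain c) :
    c.1 = comp {e | ∃ a b, s.Step a b ∧ b ≤ c ∧ e ∈ labelOrbits a.1 b.1} := by
  induction c using WellFoundedLT.induction with
  | ind c ih =>
    refine le_antisymm ?_ (comp_le fun e ⟨a, b, hs, hbc, he⟩ x hx y hy =>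
      hbc (rel_of_mem_labelOrbits hs.le he hx hy))
    by_cases h : c.1 = ⊥
    · rw [h]
      exact bot_le
    obtain ⟨a, ha⟩ := exists_step hp hc h
    refine le_of_labelOrbits (a := a.1) ?_ fun e he x hx y hy => ?_
    swap
    · have hmem : e ∈ {e | ∃ a b, s.Step a b ∧ b ≤ c ∧ e ∈ labelOrbits a.1 b.1} :=
        ⟨a, c, ha, le_rfl, he⟩
      exact comp_of_mem hmem hx hy
    rw [ih a ha.lt ha.1]
    refine comp_mono ?_
    rintro e ⟨a', b, hs, hba, he⟩
    exact ⟨a', b, hs, hba.trans ha.lt.le, he⟩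

/-! ### From simplices to hypertrees -/

/-- The weakly ordered hypergraph read off from the labels of a chain. -/
def standardName (hp : IsClockwisePolygon p) (s : LinkSimplex p) :
    WeaklyOrderedHypergraph (Fin (n + 1)) where
  vertexSet := Set.univ
  edgeSet := {e | ∃ a b, s.Step a b ∧ e ∈ labelOrbits a.1 b.1}
  subset_vertexSet_of_mem_edgeSet' := fun _ _ => Set.subset_univ _
  vertexSet_eq := rfl
  nontrivial_of_mem := fun _ ⟨_, _, _, he⟩ => labelOrbits_nontrivial he
  le e e' := ∃ a b a' b', s.Step a b ∧ s.Step a' b' ∧ e ∈ labelOrbits a.1 b.1 ∧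
    e' ∈ labelOrbits a'.1 b'.1 ∧ a ≤ a'
  mem_of_le := fun _ _ ⟨a, b, a', b', h, h', he, he', _⟩ => ⟨⟨a, b, h, he⟩, ⟨a', b', h', he'⟩⟩
  le_total := fun _ ⟨a, b, h, he⟩ _ ⟨a', b', h', he'⟩ =>
    (h.1.total h'.1).imp (fun hle => ⟨a, b, a', b', h, h', he, he', hle⟩)
      fun hle => ⟨a', b', a, b, h', h, he', he, hle⟩
  le_trans := by
    rintro e e' e'' ⟨a, b, a', b', h, h', he, he', hle⟩ ⟨c, d, c', d', k, k', ke, ke', kle⟩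
    obtain rfl := h'.eq_of_mem hp k he' ke
    exact ⟨a, b, c', d', h, k', he, ke', hle.trans kle⟩

theorem isStandardName_iff {s : LinkSimplex p} {τ : WeaklyOrderedHypergraph (Fin (n + 1))} :
    IsStandardName s τ ↔
      (∀ e, e ∈ τ.edgeSet ↔ ∃ a b, s.Step a b ∧ e ∈ labelOrbits a.1 b.1) ∧
        ∀ a b a' b' e e', s.Step a b → s.Step a' b' → e ∈ labelOrbits a.1 b.1 →
          e' ∈ labelOrbits a'.1 b'.1 → (τ.le e e' ↔ a ≤ a') := by
  simp only [IsStandardName, labelEdges_eq]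

theorem isStandardName_standardName (hp : IsClockwisePolygon p) (s : LinkSimplex p) :
    IsStandardName s (s.standardName hp) := by
  refine isStandardName_iff.2 ⟨fun e => Iff.rfl, fun a b a' b' e e' h h' he he' => ⟨?_, ?_⟩⟩
  · rintro ⟨c, d, c', d', k, k', ke, ke', kle⟩
    rwa [h.eq_of_mem hp k he ke, h'.eq_of_mem hp k' he' ke']
  · exact fun hle => ⟨a, b, a', b', h, h', he, he', hle⟩

theorem isGapOrdered_standardName (hp : IsClockwisePolygon p) (s : LinkSimplex p) :
    (s.standardName hp).IsGapOrdered := by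
  rintro e - f - hne ⟨a, b, a', b', h, h', hf, he, hle⟩
  exact h.inGap_of_le hp h' hf he hne hle

theorem comp_standardName (hp : IsClockwisePolygon p) (s : LinkSimplex p) :
    comp (s.standardName hp).edgeSet = ⊤ := by
  obtain ⟨c, hc⟩ := exists_eq_top p
  have h : s.InChain c := Or.inr (Or.inr hc)
  rw [eq_top_iff, ← hc, h.eq_comp hp]
  exact comp_mono fun e ⟨a, b, hs, _, he⟩ => ⟨a, b, hs, he⟩

theorem _root_.Noncrossing.IsStandardName.unique {s : LinkSimplex p}
    {τ τ' : WeaklyOrderedHypergraph (Fin (n + 1))} (h : IsStandardName s τ)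
    (h' : IsStandardName s τ') : τ = τ' := by
  ext x y
  · rw [τ.vertexSet_eq, τ'.vertexSet_eq]
  · rw [h.1, h'.1]
  · constructor
    · intro hle
      obtain ⟨⟨a, b, hs, he⟩, ⟨a', b', hs', he'⟩⟩ :=
        (τ.mem_of_le _ _ hle).imp (h.1 _).1 (h.1 _).1
      exact (h'.2 _ _ _ _ _ _ hs hs' he he').2 ((h.2 _ _ _ _ _ _ hs hs' he he').1 hle)
    · intro hle
      obtain ⟨⟨a, b, hs, he⟩, ⟨a', b', hs', he'⟩⟩ :=
        (τ'.mem_of_le _ _ hle).imp (h'.1 _).1 (h'.1 _).1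
      exact (h.2 _ _ _ _ _ _ hs hs' he he').2 ((h'.2 _ _ _ _ _ _ hs hs' he he').1 hle)

end LinkSimplex

/-- A set of hyperedges that is an initial segment of the weak ordering. -/
def WeaklyOrderedHypergraph.IsInitial {V : Type*} (τ : WeaklyOrderedHypergraph V)
    (D : Set (Set V)) : Prop :=
  D ⊆ τ.edgeSet ∧ ∀ e ∈ D, ∀ f, τ.le f e → f ∈ D

namespace LinkSimplex

variable {n : ℕ} {p : Fin (n + 1) → ℝ × ℝ}

/-- The chain is recovered from the initial segments of the weakly ordered hypergraph. -/
theorem inChain_iff {s : LinkSimplex p} (hp : IsClockwisePolygon p)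
    {τ : WeaklyOrderedHypergraph (Fin (n + 1))} (h : IsStandardName s τ) {c : NCPartition p} :
    s.InChain c ↔ ∃ D, τ.IsInitial D ∧ c.1 = comp D := by
  have hτ := isStandardName_iff.1 h
  have hinit : ∀ c, s.InChain c →
      τ.IsInitial {e | ∃ a b, s.Step a b ∧ b ≤ c ∧ e ∈ labelOrbits a.1 b.1} := by
    refine fun c hc => ⟨fun e ⟨a, b, hs, _, he⟩ => (hτ.1 e).2 ⟨a, b, hs, he⟩, ?_⟩
    rintro e ⟨a, b, hs, hbc, he⟩ f hle
    obtain ⟨a', b', hs', hf⟩ := (hτ.1 f).1 (τ.mem_of_le _ _ hle).1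
    have haa := (hτ.2 _ _ _ _ _ _ hs' hs hf he).1 hle
    exact ⟨a', b', hs', hs'.le_of_lt hc (haa.trans_lt (hs.lt.trans_le hbc)), hf⟩
  refine ⟨fun hc => ⟨_, hinit c hc, hc.eq_comp hp⟩, ?_⟩
  rintro ⟨D, hD, hcD⟩
  rcases D.eq_empty_or_nonempty with rfl | ⟨e₀, he₀⟩
  · refine Or.inr (Or.inl (hcD.trans (eq_bot_iff.2 (comp_le ?_))))
    simp
  obtain ⟨a₀, b₀, hs₀, heo⟩ := (hτ.1 _).1 (hD.1 he₀)
  -- Take the last step whose label meets `D`. As `D` is initial, it consists of all labels up to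
  -- the upper end `b` of that step.
  obtain ⟨b, hb⟩ := (Set.toFinite
    {b | ∃ a, s.Step a b ∧ ∃ e ∈ D, e ∈ labelOrbits a.1 b.1}).exists_maximal ⟨b₀, a₀, hs₀, e₀, he₀, heo⟩
  obtain ⟨⟨a, hs, e, heD, he⟩, hmax⟩ := hb
  have hDb : D = {e | ∃ a' b', s.Step a' b' ∧ b' ≤ b ∧ e ∈ labelOrbits a'.1 b'.1} := by
    ext f
    constructor
    · intro hf
      obtain ⟨a', b', hs', hf'⟩ := (hτ.1 _).1 (hD.1 hf)
      refine ⟨a', b', hs', ?_, hf'⟩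
      rcases hs'.2.1.total hs.2.1 with hle | hle
      · exact hle
      · exact hmax ⟨a', hs', f, hf, hf'⟩ hle
    · rintro ⟨a', b', hs', hbb, hf⟩
      refine hD.2 e heD f ((hτ.2 _ _ _ _ _ _ hs' hs hf he).2 ?_)
      rcases hs'.1.total hs.1 with hle | hle
      · exact hle
      · rcases hle.lt_or_eq with hlt | rfl
        · exact absurd (hs.le_of_lt hs'.1 hlt) (not_le_of_gt (hs'.lt.trans_le hbb))
        · exact le_rfl
  have : c = b := Subtype.ext (by rw [hcD, hDb, hs.2.1.eq_comp hp])
  exact this ▸ hs.2.1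

theorem mem_verts_iff {s : LinkSimplex p} {c : NCPartition p} :
    c ∈ s.verts ↔ s.InChain c ∧ c.1 ≠ ⊥ ∧ c.1 ≠ ⊤ := by
  refine ⟨fun h => ⟨Or.inl h, s.ne_bot c h, s.ne_top c h⟩, ?_⟩
  rintro ⟨h | h | h, h1, h2⟩
  · exact h
  · exact (h1 h).elim
  · exact (h2 h).elim

theorem eq_of_verts_eq {s t : LinkSimplex p} (h : s.verts = t.verts) : s = t := by
  cases s
  cases t
  congr

theorem eq_of_isStandardName {s t : LinkSimplex p} (hp : IsClockwisePolygon p)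
    {τ : WeaklyOrderedHypergraph (Fin (n + 1))} (hs : IsStandardName s τ)
    (ht : IsStandardName t τ) : s = t :=
  eq_of_verts_eq (Finset.ext fun c => by
    rw [mem_verts_iff, mem_verts_iff, inChain_iff hp hs, inChain_iff hp ht])

end LinkSimplex

namespace WeaklyOrderedHypergraph

/-! ### The chain of a weakly properly ordered noncrossing hypertree -/

variable {m : ℕ} {τ : WeaklyOrderedHypergraph (Fin m)}

theorem le_refl {V : Type*} {τ : WeaklyOrderedHypergraph V} {e : Set V} (he : e ∈ τ.edgeSet) :
    τ.le e e :=
  (or_self_iff).1 (τ.le_total e he e he)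

theorem IsInitial.total {V : Type*} {τ : WeaklyOrderedHypergraph V} {D D' : Set (Set V)}
    (h : τ.IsInitial D) (h' : τ.IsInitial D') : D ⊆ D' ∨ D' ⊆ D := by
  by_contra! hn
  obtain ⟨h1, h2⟩ := hn
  obtain ⟨e, he, he'⟩ := Set.not_subset.1 h1
  obtain ⟨f, hf, hf'⟩ := Set.not_subset.1 h2
  rcases τ.le_total e (h.1 he) f (h'.1 hf) with hle | hle
  · exact he' (h'.2 f hf e hle)
  · exact hf' (h.2 e he f hle)

theorem IsInitial.inGap (hτ : τ.IsGapOrdered) {D : Set (Set (Fin m))} (hD : τ.IsInitial D)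
    {e f : Set (Fin m)} (he : e ∈ τ.edgeSet) (he' : e ∉ D) (hf : f ∈ D) : InGap f e := by
  refine hτ e he f (hD.1 hf) (fun h => he' (h ▸ hf)) ?_
  exact (τ.le_total f (hD.1 hf) e he).resolve_right fun h => he' (hD.2 f hf e h)

/-- If `e ∈ D` is not in `D'`, all of `D'` lies in gaps of `e`, so `comp D'` separates the elements
of `e` while `comp D` joins them. -/
theorem IsInitial.comp_le_iff (hτ : τ.IsGapOrdered) {D D' : Set (Set (Fin m))}
    (hD : τ.IsInitial D) (hD' : τ.IsInitial D') : comp D ≤ comp D' ↔ D ⊆ D' := by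
  refine ⟨fun h e he => ?_, comp_mono⟩
  by_contra hn
  obtain ⟨x, hx, y, hy, hxy⟩ := τ.nontrivial_of_mem e (hD.1 he)
  have h1 : comp D' ≤ gap e := comp_le fun f hf => hD'.inGap hτ (hD.1 he) hn hf
  exact hxy (eq_of_gap hx hy (h1 (h (comp_of_mem he hx hy))))

theorem IsGapOrdered.not_crosses (hτ : τ.IsGapOrdered) {e f : Set (Fin m)}
    (he : e ∈ τ.edgeSet) (hf : f ∈ τ.edgeSet) (hne : e ≠ f) : ¬ Crosses e f := by
  rcases τ.le_total e he f hf with h | h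
  · exact (hτ f hf e he hne h).not_crosses
  · exact fun hc => (hτ e he f hf hne.symm h).not_crosses hc.symm

theorem IsGapOrdered.nonCrossingPartition (hτ : τ.IsGapOrdered) {D : Set (Set (Fin m))}
    (hD : D ⊆ τ.edgeSet) : NonCrossingPartition (comp D) := by
  refine fun x y hxy => comp_not_crosses (fun e he f hf hd => ?_) hxy
  refine hτ.not_crosses (hD he) (hD hf) ?_
  rintro rfl
  exact (τ.nontrivial_of_mem e (hD he)).nonempty.ne_empty (disjoint_self.1 hd)

/-- The hyperedges strictly before `e`. -/
def before {V : Type*} (τ : WeaklyOrderedHypergraph V) (e : Set V) : Set (Set V) :=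
  {f | f ∈ τ.edgeSet ∧ ¬ τ.le e f}

/-- The hyperedges that are tied with `e`. -/
def tied {V : Type*} (τ : WeaklyOrderedHypergraph V) (e : Set V) : Set (Set V) :=
  {f | τ.le e f ∧ τ.le f e}

theorem isInitial_before {V : Type*} (τ : WeaklyOrderedHypergraph V) (e : Set V) :
    τ.IsInitial (τ.before e) :=
  ⟨fun _ h => h.1, fun _ h _ hf =>
    ⟨(τ.mem_of_le _ _ hf).1, fun h' => h.2 (τ.le_trans _ _ _ h' hf)⟩⟩

theorem before_union_tied {V : Type*} (τ : WeaklyOrderedHypergraph V) {e : Set V}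
    (he : e ∈ τ.edgeSet) : τ.before e ∪ τ.tied e = {f | τ.le f e} := by
  ext f
  constructor
  · rintro (h | h)
    · exact (τ.le_total _ h.1 _ he).resolve_right h.2
    · exact h.2
  · intro h
    by_cases h' : τ.le e f
    · exact Or.inr ⟨h', h⟩
    · exact Or.inl ⟨(τ.mem_of_le _ _ h).1, h'⟩

theorem isInitial_le {V : Type*} (τ : WeaklyOrderedHypergraph V) (e : Set V) :
    τ.IsInitial {f | τ.le f e} :=
  ⟨fun _ h => (τ.mem_of_le _ _ h).1, fun _ h _ hf => τ.le_trans _ _ _ hf h⟩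

theorem labelOrbits_before (hτ : τ.IsGapOrdered) {e : Set (Fin m)} (he : e ∈ τ.edgeSet) :
    labelOrbits (comp (τ.before e)) (comp {f | τ.le f e}) = τ.tied e := by
  have hte : τ.tied e ⊆ τ.edgeSet := fun f hf => (τ.mem_of_le _ _ hf.1).2
  rw [← before_union_tied τ he]
  refine labelOrbits_comp (fun f hf => τ.nontrivial_of_mem f (hte hf))
    (hτ.nonCrossingPartition (isInitial_before τ e).1) ?_ ?_
  · intro f hf g hg
    exact (isInitial_before τ e).inGap hτ (hte hf) (fun h => h.2 hf.1) hg
  · intro f hf g hg hne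
    exact hτ f (hte hf) g (hte hg) hne (τ.le_trans _ _ _ hg.2 hf.1)

end WeaklyOrderedHypergraph

/-! ### From hypertrees to simplices -/

open WeaklyOrderedHypergraph

variable {n : ℕ} {p : Fin (n + 1) → ℝ × ℝ}

/-- The simplex formed by the partitions into components of the initial segments of a weakly
ordered hypergraph. -/
noncomputable def simplexOf (p : Fin (n + 1) → ℝ × ℝ)
    (τ : WeaklyOrderedHypergraph (Fin (n + 1))) : LinkSimplex p where
  verts := (Set.toFinite {c : NCPartition p |
    (c.1 ≠ ⊥ ∧ c.1 ≠ ⊤) ∧ ∃ D, τ.IsInitial D ∧ c.1 = comp D}).toFinset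
  isChain := by
    intro c hc d hd _
    simp only [Set.Finite.coe_toFinset, Set.mem_ofPred_eq] at hc hd
    obtain ⟨-, D, hD, hcD⟩ := hc
    obtain ⟨-, D', hD', hdD⟩ := hd
    refine (hD.total hD').imp (fun h => ?_) fun h => ?_
    · exact show c.1 ≤ d.1 from hcD ▸ hdD ▸ comp_mono h
    · exact show d.1 ≤ c.1 from hcD ▸ hdD ▸ comp_mono h
  ne_bot := fun c hc => ((Set.Finite.mem_toFinset _).1 hc).1.1
  ne_top := fun c hc => ((Set.Finite.mem_toFinset _).1 hc).1.2

theorem inChain_simplexOf {τ : WeaklyOrderedHypergraph (Fin (n + 1))}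
    (htop : comp τ.edgeSet = ⊤) {c : NCPartition p} :
    (simplexOf p τ).InChain c ↔ ∃ D, τ.IsInitial D ∧ c.1 = comp D := by
  have hv : c ∈ (simplexOf p τ).verts ↔
      (c.1 ≠ ⊥ ∧ c.1 ≠ ⊤) ∧ ∃ D, τ.IsInitial D ∧ c.1 = comp D := by
    simp [simplexOf]
  constructor
  · rintro (h | h | h)
    · exact (hv.1 h).2
    · refine ⟨∅, ⟨Set.empty_subset _, fun _ h => h.elim⟩, ?_⟩
      rw [h, eq_comm, eq_bot_iff]
      exact comp_le fun _ h => h.elim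
    · exact ⟨_, ⟨subset_rfl, fun _ _ _ h => (τ.mem_of_le _ _ h).1⟩, h.trans htop.symm⟩
  · intro h
    by_cases h1 : c.1 = ⊥
    · exact Or.inr (Or.inl h1)
    by_cases h2 : c.1 = ⊤
    · exact Or.inr (Or.inr h2)
    exact Or.inl (hv.2 ⟨⟨h1, h2⟩, h⟩)

/-- The adjacent pairs of the chain are given by the levels of the weak ordering. -/
theorem step_simplexOf (hp : IsClockwisePolygon p) {τ : WeaklyOrderedHypergraph (Fin (n + 1))}
    (htop : comp τ.edgeSet = ⊤) (hτ : τ.IsGapOrdered) {a b : NCPartition p} :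
    (simplexOf p τ).Step a b ↔
      ∃ e ∈ τ.edgeSet, a.1 = comp (τ.before e) ∧ b.1 = comp {f | τ.le f e} := by
  have hex : ∀ D, τ.IsInitial D →
      ∃ c : NCPartition p, (simplexOf p τ).InChain c ∧ c.1 = comp D := fun D hD =>
    ⟨⟨comp D, (nonCrossingPartition_iff hp _).2 (hτ.nonCrossingPartition hD.1)⟩,
      (inChain_simplexOf htop).2 ⟨D, hD, rfl⟩, rfl⟩
  have hle : ∀ (c d : NCPartition p) (D D'), τ.IsInitial D → τ.IsInitial D' → c.1 = comp D →
      d.1 = comp D' → (c ≤ d ↔ D ⊆ D') := fun c d D D' hD hD' hc hd => by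
    rw [← IsInitial.comp_le_iff hτ hD hD', ← hc, ← hd]
    rfl
  constructor
  · rintro ⟨ha, hb, hab, hcov⟩
    obtain ⟨D, hD, haD⟩ := (inChain_simplexOf htop).1 ha
    obtain ⟨D', hD', hbD⟩ := (inChain_simplexOf htop).1 hb
    have hDD := (hle _ _ _ _ hD' hD hbD haD).not.1 (not_le_of_gt hab)
    -- For any `e` in `D'` but not in `D`, the segments strictly before `e` and up to `e` both lie
    -- between `D` and `D'`; adjacency forces them to give `a` and `b`.
    obtain ⟨e, he, he'⟩ := Set.not_subset.1 hDD
    have heE := hD'.1 he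
    obtain ⟨c, hc, hce⟩ := hex _ (isInitial_before τ e)
    obtain ⟨d, hd, hde⟩ := hex _ (isInitial_le τ e)
    refine ⟨e, heE, ?_, ?_⟩
    · have hac : a ≤ c := (hle _ _ _ _ hD (isInitial_before τ e) haD hce).2 fun f hf =>
        ⟨hD.1 hf, fun h => he' (hD.2 f hf e h)⟩
      have hcb : ¬ b ≤ c := (hle _ _ _ _ hD' (isInitial_before τ e) hbD hce).not.2 fun h =>
        (h he).2 (le_refl heE)
      have hcb' : c < b := lt_of_le_not_ge ((hc.total hb).resolve_right hcb) hcb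
      rcases hac.lt_or_eq with h | h
      · exact (hcov c hc ⟨h, hcb'⟩).elim
      · rw [h, hce]
    · have hdb : d ≤ b := (hle _ _ _ _ (isInitial_le τ e) hD' hde hbD).2 fun f hf =>
        hD'.2 e he f hf
      have had : ¬ d ≤ a := (hle _ _ _ _ (isInitial_le τ e) hD hde haD).not.2 fun h =>
        he' (h (le_refl heE))
      have had' : a < d := lt_of_le_not_ge ((ha.total hd).resolve_right had) had
      rcases hdb.lt_or_eq with h | h
      · exact (hcov d hd ⟨had', h⟩).elim
      · rw [← h, hde]
  · rintro ⟨e, he, hae, hbe⟩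
    have hi := isInitial_before τ e
    have hi' := isInitial_le τ e
    refine ⟨(inChain_simplexOf htop).2 ⟨_, hi, hae⟩, (inChain_simplexOf htop).2 ⟨_, hi', hbe⟩,
      lt_of_le_not_ge ((hle _ _ _ _ hi hi' hae hbe).2 fun f hf => ?_)
        ((hle _ _ _ _ hi' hi hbe hae).not.2 fun h => (h (le_refl he)).2 (le_refl he)), ?_⟩
    · exact (τ.le_total _ hf.1 _ he).resolve_right hf.2
    · rintro c hc ⟨hac, hcb⟩
      obtain ⟨D, hD, hcD⟩ := (inChain_simplexOf htop).1 hc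
      have h1 := (hle _ _ _ _ hD hi hcD hae).not.1 (not_le_of_gt hac)
      have h2 := (hle _ _ _ _ hi' hD hbe hcD).not.1 (not_le_of_gt hcb)
      obtain ⟨g, hg, hg'⟩ := Set.not_subset.1 h1
      have heg : τ.le e g := by
        by_contra h
        exact hg' ⟨hD.1 hg, h⟩
      exact h2 fun f hf => hD.2 e (hD.2 g hg e heg) f hf

theorem isStandardName_simplexOf (hp : IsClockwisePolygon p)
    {τ : WeaklyOrderedHypergraph (Fin (n + 1))} (htop : comp τ.edgeSet = ⊤)
    (hτ : τ.IsGapOrdered) : IsStandardName (simplexOf p τ) τ := by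
  have hpart : ∀ D, τ.IsInitial D → ∃ c : NCPartition p, c.1 = comp D := fun D hD =>
    ⟨⟨comp D, (nonCrossingPartition_iff hp _).2 (hτ.nonCrossingPartition hD.1)⟩, rfl⟩
  refine LinkSimplex.isStandardName_iff.2 ⟨fun e => ⟨fun he => ?_, ?_⟩, ?_⟩
  · obtain ⟨a, ha⟩ := hpart _ (isInitial_before τ e)
    obtain ⟨b, hb⟩ := hpart _ (isInitial_le τ e)
    refine ⟨a, b, (step_simplexOf hp htop hτ).2 ⟨e, he, ha, hb⟩, ?_⟩
    rw [ha, hb, labelOrbits_before hτ he]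
    exact ⟨le_refl he, le_refl he⟩
  · rintro ⟨a, b, hs, he⟩
    obtain ⟨f, hf, ha, hb⟩ := (step_simplexOf hp htop hτ).1 hs
    rw [ha, hb, labelOrbits_before hτ hf] at he
    exact (τ.mem_of_le _ _ he.2).1
  · intro a b a' b' e e' hs hs' he he'
    obtain ⟨f, hf, ha, hb⟩ := (step_simplexOf hp htop hτ).1 hs
    obtain ⟨f', hf', ha', hb'⟩ := (step_simplexOf hp htop hτ).1 hs'
    rw [ha, hb, labelOrbits_before hτ hf] at he
    rw [ha', hb', labelOrbits_before hτ hf'] at he'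
    have h1 : a ≤ a' ↔ τ.before f ⊆ τ.before f' := by
      rw [← IsInitial.comp_le_iff hτ (isInitial_before τ f) (isInitial_before τ f'), ← ha, ← ha']
      rfl
    rw [h1]
    constructor
    · intro h g hg
      exact ⟨hg.1, fun h' => hg.2 (τ.le_trans _ _ _ he.1 (τ.le_trans _ _ _ h
        (τ.le_trans _ _ _ he'.2 h')))⟩
    · intro h
      by_contra hn
      have : ¬ τ.le f f' := fun h' => hn (τ.le_trans _ _ _ he.2 (τ.le_trans _ _ _ h' he'.1))
      exact (h ⟨hf', this⟩).2 (le_refl hf')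

/-- The bijection from simplices of the link to weakly properly ordered noncrossing
hypertrees. -/
noncomputable def standardNameEquiv (hp : IsClockwisePolygon p) :
    LinkSimplex p ≃ WeaklyProperlyOrderedHypertree p :=
  Equiv.ofBijective
    (fun s => ⟨s.standardName hp, (weaklyProperlyOrderedHypertree_iff hp).2
      ⟨s.comp_standardName hp, s.isGapOrdered_standardName hp⟩⟩)
    ⟨fun s t h => by
        have h' : s.standardName hp = t.standardName hp := congrArg Subtype.val h
        exact LinkSimplex.eq_of_isStandardName hp (s.isStandardName_standardName hp)
          (h'.symm ▸ t.isStandardName_standardName hp),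
      fun τ => ⟨simplexOf p τ.1, Subtype.ext <|
        ((simplexOf p τ.1).isStandardName_standardName hp).unique <|
          have h := (weaklyProperlyOrderedHypertree_iff hp).1 τ.2
          isStandardName_simplexOf hp h.1 h.2⟩⟩

/-! ### Partition chambers -/

/-- The least elements of the blocks of a partition. -/
def blockMins {m : ℕ} (c : Setoid (Fin m)) : Set (Fin m) :=
  {x | ∀ y, c x y → x ≤ y}

theorem exists_blockMin {m : ℕ} (c : Setoid (Fin m)) (x : Fin m) : ∃ y ∈ blockMins c, c x y := by
  obtain ⟨y, hy, hmin⟩ := Set.exists_min_image {y | c x y} id (Set.toFinite _) ⟨x, c.refl' x⟩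
  exact ⟨y, fun z hz => hmin z (c.trans' hy hz), hy⟩

theorem blockMins_anti {m : ℕ} {a b : Setoid (Fin m)} (h : a ≤ b) : blockMins b ⊆ blockMins a :=
  fun _ hx y hy => hx y (h hy)

/-- A block of `b` that contained two blocks of `a` would contain two minima of blocks of `a`, but
it has only one minimum itself. -/
theorem le_of_blockMins {m : ℕ} {a b : Setoid (Fin m)} (hab : a ≤ b)
    (h : blockMins a ⊆ blockMins b) : b ≤ a := by
  intro x y hxy
  obtain ⟨x', hx', hxx⟩ := exists_blockMin a x
  obtain ⟨y', hy', hyy⟩ := exists_blockMin a y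
  have hb : b x' y' := b.trans' (b.symm' (hab hxx)) (b.trans' hxy (hab hyy))
  have : x' = y' := le_antisymm (h hx' y' hb) (h hy' x' (b.symm' hb))
  exact a.trans' hxx (this ▸ a.symm' hyy)

theorem ncard_blockMins_lt {m : ℕ} {a b : Setoid (Fin m)} (hab : a < b) :
    (blockMins b).ncard < (blockMins a).ncard :=
  Set.ncard_lt_ncard ⟨blockMins_anti hab.le, fun h => not_le_of_gt hab (le_of_blockMins hab.le h)⟩

/-- Merging two blocks lowers the number of blocks by at most one. -/
theorem ncard_blockMins_le {m : ℕ} {a c : Setoid (Fin m)} {u v : Fin m}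
    (h : ∀ r : Setoid (Fin m), a ≤ r → r u v → c ≤ r) :
    (blockMins a).ncard ≤ (blockMins c).ncard + 1 := by
  choose ρ hρ hρ' using exists_blockMin a
  have hle : ∀ x, ρ x ≤ x := fun x => hρ x x (a.symm' (hρ' x))
  have heq : ∀ {x y}, a x y → ρ x = ρ y := fun {x y} hxy => le_antisymm
    (hρ x _ (a.trans' (a.symm' (hρ' x)) (a.trans' hxy (hρ' y))))
    (hρ y _ (a.trans' (a.symm' (hρ' y)) (a.trans' (a.symm' hxy) (hρ' x))))
  have hfix : ∀ x ∈ blockMins a, ρ x = x := fun x hx => le_antisymm (hle x) (hx _ (hρ' x))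
  wlog huv : ρ u ≤ ρ v generalizing u v
  · exact this (fun r har hr => h r har (r.symm' hr)) (le_of_not_ge huv)
  -- The join of the blocks of `u` and `v`, made by redirecting the larger minimum `ρ v` to `ρ u`;
  -- every other minimum survives in `c`.
  have hc := h (Setoid.ker fun x => if ρ x = ρ v then ρ u else ρ x)
    (fun x y hxy => by simp only [Setoid.ker_def, heq hxy]) (by simp [Setoid.ker_def])
  have hsub : blockMins a ⊆ insert (ρ v) (blockMins c) := by
    intro z hz
    by_cases hzv : z = ρ v
    · exact Or.inl hzv
    refine Or.inr fun y hy => ?_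
    have := hc hy
    simp only [Setoid.ker_def, hfix z hz, if_neg hzv] at this
    rw [this]
    split_ifs with hy'
    · exact (huv.trans_eq hy'.symm).trans (hle y)
    · exact hle y
  exact (Set.ncard_le_ncard hsub).trans (Set.ncard_insert_le _ _)

namespace LinkSimplex

variable {n : ℕ} {p : Fin (n + 1) → ℝ × ℝ}

/-- The two bounding elements coincide for `n = 0`. Their number is left unevaluated because it is
the same for all simplices. -/
theorem ncard_inChain (s : LinkSimplex p) : {c | s.InChain c}.ncard =
    s.verts.card + {c : NCPartition p | c.1 = ⊥ ∨ c.1 = ⊤}.ncard := by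
  rw [← Set.ncard_coe_finset, ← Set.ncard_union_eq]
  · rfl
  · rw [Set.disjoint_left]
    rintro c hc (h | h)
    · exact s.ne_bot c hc h
    · exact s.ne_top c hc h

/-- The number of blocks is injective on a chain and lies between `1` (the vertex `0` is always a
block minimum) and `n + 1`. -/
theorem ncard_inChain_le (s : LinkSimplex p) : {c | s.InChain c}.ncard ≤ n + 1 := by
  have hinj : Set.InjOn (fun c : NCPartition p => (blockMins c.1).ncard) {c | s.InChain c} := by
    intro c hc d hd h
    by_contra hne
    have hne' : c.1 ≠ d.1 := fun h => hne (Subtype.ext h)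
    rcases InChain.total hc hd with hle | hle
    · exact (ncard_blockMins_lt (lt_of_le_of_ne hle hne')).ne' h
    · exact (ncard_blockMins_lt (lt_of_le_of_ne hle hne'.symm)).ne h
  have := Set.ncard_le_ncard_of_injOn (t := Set.Icc 1 (n + 1)) _ (fun c _ => ?_) hinj
    (Set.finite_Icc _ _)
  · simpa using this
  · refine ⟨?_, ?_⟩
    · exact Nat.one_le_iff_ne_zero.2
        (Set.ncard_ne_zero_of_mem (a := 0) fun y _ => Fin.zero_le y)
    · exact (Set.ncard_le_card _).trans_eq (by simp)

/-- A chain in which every step merges only two blocks has the maximal length. -/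
theorem le_ncard_inChain {s : LinkSimplex p} (hp : IsClockwisePolygon p)
    (h : ∀ a b, s.Step a b → ∃ u v, ∀ r : Setoid (Fin (n + 1)), a.1 ≤ r → r u v → b.1 ≤ r) :
    n + 1 ≤ {c | s.InChain c}.ncard := by
  -- Equality holds at the bottom, with one element and `n + 1` blocks. Each step adds an element
  -- and loses at most one block; at the top one block is left.
  have key : ∀ c, s.InChain c →
      n + 2 ≤ {d | s.InChain d ∧ d ≤ c}.ncard + (blockMins c.1).ncard := by
    intro c hc
    induction c using WellFoundedLT.induction with
    | ind c ih =>
      by_cases hbot : c.1 = ⊥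
      · have h1 : blockMins c.1 = Set.univ := by
          rw [hbot]
          exact Set.eq_univ_of_forall fun x y hxy => le_of_eq hxy
        have h2 : {d | s.InChain d ∧ d ≤ c}.ncard ≠ 0 :=
          Set.ncard_ne_zero_of_mem (a := c) ⟨hc, le_rfl⟩
        rw [h1, Set.ncard_univ, Nat.card_fin]
        omega
      · obtain ⟨a, ha⟩ := exists_step hp hc hbot
        obtain ⟨u, v, huv⟩ := h a c ha
        have h1 := ih a ha.lt ha.1
        have h2 := ncard_blockMins_le huv
        have h3 : {d | s.InChain d ∧ d ≤ a}.ncard < {d | s.InChain d ∧ d ≤ c}.ncard :=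
          Set.ncard_lt_ncard ⟨fun d hd => ⟨hd.1, hd.2.trans ha.lt.le⟩,
            fun hsub => not_le_of_gt ha.lt (hsub ⟨hc, le_rfl⟩).2⟩
        omega
  obtain ⟨t, ht⟩ := exists_eq_top p
  have h1 := key t (Or.inr (Or.inr ht))
  have h2 : blockMins t.1 = {0} := by
    rw [ht]
    ext x
    refine ⟨fun hx => le_antisymm (hx 0 trivial) (Fin.zero_le x), ?_⟩
    rintro rfl y -
    exact Fin.zero_le y
  have h3 : {d | s.InChain d ∧ d ≤ t}.ncard ≤ {c | s.InChain c}.ncard :=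
    Set.ncard_le_ncard fun d hd => hd.1
  rw [h2, Set.ncard_singleton] at h1
  omega

/-- The steps of a chamber are coverings in the noncrossing partition lattice. -/
theorem IsChamber.not_lt_lt {s : LinkSimplex p} (hs : s.IsChamber) {a b c : NCPartition p}
    (h : s.Step a b) : ¬ (a < c ∧ c < b) := by
  classical
  rintro ⟨hac, hcb⟩
  have hc : c ∉ s.verts := fun hc => h.2.2.2 c (Or.inl hc) ⟨hac, hcb⟩
  have hcomp : ∀ d ∈ s.verts, c ≤ d ∨ d ≤ c := by
    intro d hd
    rcases h.1.total (Or.inl hd) with hle | hle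
    · rcases hle.lt_or_eq with hlt | rfl
      · exact Or.inl (hcb.le.trans (h.le_of_lt (Or.inl hd) hlt))
      · exact Or.inr hac.le
    · exact Or.inr (hle.trans hac.le)
  let t : LinkSimplex p :=
    { verts := insert c s.verts
      isChain := by
        rw [Finset.coe_insert]
        exact s.isChain.insert fun d hd _ => hcomp d hd
      ne_bot := by
        intro d hd
        rcases Finset.mem_insert.1 hd with rfl | hd
        · exact fun hbot => not_le_of_gt hac (show d.1 ≤ a.1 from hbot ▸ bot_le)
        · exact s.ne_bot d hd
      ne_top := by
        intro d hd
        rcases Finset.mem_insert.1 hd with rfl | hd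
        · exact fun htop => not_le_of_gt hcb (show b.1 ≤ d.1 from htop ▸ le_top)
        · exact s.ne_top d hd }
  have h1 := hs t
  have h2 : t.verts.card = s.verts.card + 1 := Finset.card_insert_of_notMem hc
  omega

theorem le_gap_of_mem {m : ℕ} {a b : Setoid (Fin m)} (ha : NonCrossingPartition a)
    (hb : NonCrossingPartition b) (hab : a ≤ b) {e : Set (Fin m)} (he : e ∈ labelOrbits a b) :
    a ≤ gap e := by
  obtain ⟨v, hv, rfl⟩ := he
  exact le_gap_permLabel ha hb hab hv

/-- If `a` is joined with a subset `e'` of a hyperedge `e` of the label of `a < b`, the result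
is a noncrossing partition; in a chamber it is `a` or `b`. -/
theorem IsChamber.le_of_subset {s : LinkSimplex p} (hp : IsClockwisePolygon p)
    (hs : s.IsChamber) {a b : NCPartition p} (h : s.Step a b) {e e' : Set (Fin (n + 1))}
    (he : e ∈ labelOrbits a.1 b.1) (hee : e' ⊆ e) (he' : e'.Nontrivial) {r : Setoid (Fin (n + 1))}
    (har : a.1 ≤ r) (her : ∀ x ∈ e', ∀ y ∈ e', r x y) : b.1 ≤ r := by
  have hag := le_gap_of_mem (a.nonCrossing hp) (b.nonCrossing hp) h.le he
  set D : Set (Set (Fin (n + 1))) :=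
    {e | ∃ a' b', s.Step a' b' ∧ b' ≤ a ∧ e ∈ labelOrbits a'.1 b'.1} with hD
  have haD : a.1 = comp D := h.1.eq_comp hp
  have hDE : ∀ f ∈ D, f ∈ (s.standardName hp).edgeSet ∧ f ≠ e := by
    intro f hf
    refine ⟨?_, ?_⟩
    · obtain ⟨a', b', hs', -, hf'⟩ := hf
      exact ⟨a', b', hs', hf'⟩
    · rintro rfl
      obtain ⟨x, hx, y, hy, hxy⟩ := labelOrbits_nontrivial he
      exact hxy (eq_of_gap hx hy (hag (haD ▸ comp_of_mem hf hx hy)))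
  have heE : e ∈ (s.standardName hp).edgeSet := ⟨a, b, h, he⟩
  have hτ := s.isGapOrdered_standardName hp
  -- The subset `e'` crosses nothing that `e` does not cross.
  have hnc : NonCrossingPartition (comp (insert e' D)) := by
    refine fun x y hxy => comp_not_crosses ?_ hxy
    rintro f (rfl | hf) g (rfl | hg) hd
    · exact (he'.nonempty.ne_empty (disjoint_self.1 hd)).elim
    · exact fun hc => hτ.not_crosses heE (hDE g hg).1 (hDE g hg).2.symm
        (hc.mono hee subset_rfl)
    · exact fun hc => hτ.not_crosses (hDE f hf).1 heE (hDE f hf).2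
        (hc.mono subset_rfl hee)
    · by_cases hfg : f = g
      · subst hfg
        exact ((labelOrbits_nontrivial hf.choose_spec.choose_spec.2.2).nonempty.ne_empty
          (disjoint_self.1 hd)).elim
      · exact hτ.not_crosses (hDE f hf).1 (hDE g hg).1 hfg
  let c : NCPartition p := ⟨comp (insert e' D), (nonCrossingPartition_iff hp _).2 hnc⟩
  have hac : a < c := by
    refine lt_of_le_not_ge (show a.1 ≤ c.1 from haD ▸ comp_mono (Set.subset_insert _ _)) ?_
    intro hca
    obtain ⟨x, hx, y, hy, hxy⟩ := he'
    exact hxy (eq_of_gap (hee hx) (hee hy) (hag (hca (comp_of_mem (Set.mem_insert _ _) hx hy))))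
  have hcb : c ≤ b := by
    refine comp_le ?_
    rintro f (rfl | hf) x hx y hy
    · exact rel_of_mem_labelOrbits h.le he (hee hx) (hee hy)
    · exact h.le (haD ▸ comp_of_mem hf hx hy)
  have hbc : b = c := by
    by_contra hne
    exact hs.not_lt_lt h ⟨hac, lt_of_le_of_ne hcb (Ne.symm hne)⟩
  rw [hbc]
  refine comp_le ?_
  rintro f (rfl | hf) x hx y hy
  · exact her x hx y hy
  · exact har (haD ▸ comp_of_mem hf hx hy)

/-- Take `r = gap f` in `IsChamber.le_of_subset`: it contains `a` and joins `e`. Then `b ≤ gap f`,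
although `b` joins the elements of `f`. -/
theorem IsChamber.eq_of_mem {s : LinkSimplex p} (hp : IsClockwisePolygon p)
    (hs : s.IsChamber) {a b : NCPartition p} (h : s.Step a b) {e f : Set (Fin (n + 1))}
    (he : e ∈ labelOrbits a.1 b.1) (hf : f ∈ labelOrbits a.1 b.1) : e = f := by
  by_contra hne
  have hb := hs.le_of_subset hp h he subset_rfl (labelOrbits_nontrivial he)
    (le_gap_of_mem (a.nonCrossing hp) (b.nonCrossing hp) h.le hf)
    (inGap_of_mem_labelOrbits (a.nonCrossing hp) (b.nonCrossing hp) h.le hf he hne)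
  obtain ⟨x, hx, y, hy, hxy⟩ := labelOrbits_nontrivial hf
  exact hxy (eq_of_gap hx hy (hb (rel_of_mem_labelOrbits h.le hf hx hy)))

/-- With more than two elements, `e \ {v}` could be joined without `v`: the relation `r` separating
the `a`-block of `v` from everything else would still contain `b`. -/
theorem IsChamber.ncard_eq_two {s : LinkSimplex p} (hp : IsClockwisePolygon p)
    (hs : s.IsChamber) {a b : NCPartition p} (h : s.Step a b) {e : Set (Fin (n + 1))}
    (he : e ∈ labelOrbits a.1 b.1) : e.ncard = 2 := by
  have hnt := labelOrbits_nontrivial he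
  have hag := le_gap_of_mem (a.nonCrossing hp) (b.nonCrossing hp) h.le he
  by_contra hne
  obtain ⟨v, hv⟩ := hnt.nonempty
  have h1 : 1 < e.ncard := (Set.one_lt_ncard_iff_nontrivial).2 hnt
  have hnt' : (e \ {v}).Nontrivial := by
    rw [← Set.one_lt_ncard_iff_nontrivial]
    have := Set.ncard_sdiff_singleton_add_one hv
    omega
  let r : Setoid (Fin (n + 1)) := Setoid.ker fun x => a.1 v x
  have hav : ∀ x ∈ e \ {v}, ¬ a.1 v x := fun x hx hvx =>
    hx.2 (eq_of_gap hx.1 hv (hag (a.1.symm' hvx)))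
  have hb : b.1 ≤ r := by
    refine hs.le_of_subset hp h he Set.sdiff_subset hnt' ?_ ?_
    · exact fun x y hxy => propext ⟨fun h => a.1.trans' h hxy,
        fun h => a.1.trans' h (a.1.symm' hxy)⟩
    · exact fun x hx y hy => propext (iff_of_false (hav x hx) (hav y hy))
  obtain ⟨x, hx⟩ := hnt'.nonempty
  have hvx : (a.1 v v) = (a.1 v x) := hb (rel_of_mem_labelOrbits h.le he hv hx.1)
  exact hav x hx (hvx ▸ a.1.refl' v)

theorem isChamber_iff (hp : IsClockwisePolygon p) (s : LinkSimplex p) :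
    s.IsChamber ↔ (standardNameEquiv hp s).IsProperlyOrderedTree := by
  have hval : (standardNameEquiv hp s).1 = s.standardName hp := rfl
  constructor
  · intro hs
    refine ⟨⟨(standardNameEquiv hp s).2.1, ?_⟩, ?_⟩
    · rintro e ⟨a, b, h, he⟩
      exact hs.ncard_eq_two hp h he
    · rintro e f ⟨a, b, a', b', h, h', he, hf, hle⟩ ⟨c', d', c, d, k', k, kf, ke, kle⟩
      obtain rfl := h.eq_of_mem hp k he ke
      obtain rfl := h'.eq_of_mem hp k' hf kf
      obtain rfl := le_antisymm hle kle
      obtain rfl := h.unique h'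
      exact hs.eq_of_mem hp h he hf
  · rintro ⟨⟨-, htwo⟩, hlin⟩ t
    have hmax := le_ncard_inChain (s := s) hp fun a b h => by
      obtain ⟨e, he⟩ : (labelOrbits a.1 b.1).Nonempty := by
        by_contra hn
        rw [Set.not_nonempty_iff_eq_empty] at hn
        refine not_le_of_gt h.lt (le_of_labelOrbits (a := a.1) (b := b.1) le_rfl ?_)
        rw [hn]
        exact fun e he => he.elim
      obtain ⟨u, v, -, rfl⟩ := Set.ncard_eq_two.1 (htwo e ⟨a, b, h, he⟩)
      refine ⟨u, v, fun r har hr => le_of_labelOrbits har fun f hf x hx y hy => ?_⟩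
      -- Hyperedges of the same step are tied, so linearity leaves a single one, and the step merges
      -- just the blocks of `u` and `v`.
      obtain rfl : f = {u, v} :=
        hlin _ _ ⟨a, b, a, b, h, h, hf, he, le_rfl⟩ ⟨a, b, a, b, h, h, he, hf, le_rfl⟩
      rcases hx with rfl | rfl <;> rcases hy with rfl | rfl
      · exact r.refl' _
      · exact hr
      · exact r.symm' hr
      · exact r.refl' _
    have := t.ncard_inChain_le
    have := s.ncard_inChain
    have := t.ncard_inChain
    omega

end LinkSimplex

end Noncrossing

theorem mainTheorem8 (n : ℕ) (p : Fin (n + 1) → ℝ × ℝ) (hp : Noncrossing.IsClockwisePolygon p) :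
    ∃ Φ : Noncrossing.LinkSimplex p ≃ Noncrossing.WeaklyProperlyOrderedHypertree p,
      (∀ s, Noncrossing.IsStandardName s (Φ s).1) ∧
        ∀ s, s.IsChamber ↔ (Φ s).IsProperlyOrderedTree :=
  ⟨Noncrossing.standardNameEquiv hp, fun s => s.isStandardName_standardName hp,
    fun s => s.isChamber_iff hp⟩
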